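/- Let $D\subseteq\mathbb{R}^2$ be Lebesgue measurable and let $g:D\to\mathbb{R}$ be such that 1. for every $z>0$ the function $\exp(z\,g)$ is integrable on $D$; 2. $D$ contains a neighborhood of the origin $\mathbf 0$; 3. $g$ attains its supremum over $D$ at the origin, and this supremum is approached only there: for every neighborhood $U$ of $\mathbf 0$ there is a constant $c<g(\mathbf 0)$ with $g\le c$ on $D\setminus U$ (this is automatic if $D$ is compact, $g$ is continuous and $\mathbf 0$ is the unique maximum of $g$); 4. for all $(x,y)$ in some neighborhood of the origin, $g$ is given by the (unconditionally) convergent series $$g(x,y)=-\frac{x^2}{2}-\frac{y^2}{2}+\sum_{\substack{u,w\ge 0\\ u+w\ge 3}}\Lambda_{u,w}\frac{x^uy^w}{u!\,w!},\qquad \Lambda_{u,w}\in\mathbb{R}.$$ For finite disjoint sets $S$ (red half-edges) and $T$ (yellow half-edges), an $[S,T]$-labeled edge-bicolored graph is a triple $\Gamma=(V,E_S,E_T)$, where $V$ (the vertices) is a partition of $S\sqcup T$ into non-empty blocks and $E_S$, $E_T$ (the red and the yellow edges) are partitions of $S$ and of $T$ into blocks of size $2$; the empty graph is allowed. An isomorphism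 is a pair of bijections between the sets of red and of yellow half-edges that carries $V,E_S,E_T$ to the corresponding partitions; $\operatorname{Aut}(\Gamma)$ is the group of isomorphisms of $\Gamma$ to itself. The bidegree of $v\in V$ is $\deg(v)=(|v\cap S|,|v\cap T|)$, its degree is $|v|$, and the Euler characteristic is $\chi(\Gamma)=|V|-|E_S|-|E_T|$. Let $\mathcal{G}^\star_{-n}$ be the set of isomorphism classes of such graphs (over all finite $S,T$) in which every vertex has degree at least $3$ and whose Euler characteristic is $-n$. **Theorem.** For every $n\ge 0$ the set $\mathcal{G}^\star_{-n}$ is finite, and with $$A_n=\sum_{G\in\mathcal{G}^\star_{-n}}\frac{1}{|\operatorname{Aut}(G)|}\prod_{v\in V^G}\Lambda_{\deg(v)}$$ the integral $$I(z)=\frac{z}{2\pi}\int_D \exp\bigl(z\,g(x,y)\bigr)\,dx\,dy$$ has the asymptotic expansion $I(z)\sim\sum_{n\ge 0}A_nz^{-n}$ for large $z$, that is, for every integer $R\ge 0$, $$I(z)=\sum_{n=0}^{R-1}A_nz^{-n}+\mathcal{O}(z^{-R})\qquad(z\to\infty).$$ -/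

import Mathlib

open MeasureTheory Filter Topology Asymptotics

/-- An `[S,T]`-labeled edge-bicolored graph. The elements of `S` and `T` are the red and the yellow
half-edges. The vertices are the blocks of a set partition of `S ⊕ T`, the red edges are the blocks
of a partition of `S` into pairs, the yellow edges are the blocks of a partition of `T` into
pairs. (The blocks of a `Finpartition` are non-empty, pairwise disjoint and cover the set.) -/
structure BicoloredGraph (S T : Type*) [Fintype S] [Fintype T] [DecidableEq S]
    [DecidableEq T] where
  V : Finpartition (Finset.univ : Finset (S ⊕ T))
  ES : Finpartition (Finset.univ : Finset S)
  ET : Finpartition (Finset.univ : Finset T)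
  card_ES : ∀ e ∈ ES.parts, e.card = 2
  card_ET : ∀ e ∈ ET.parts, e.card = 2

namespace BicoloredGraph

section Iso

variable {S₁ T₁ S₂ T₂ S₃ T₃ : Type*} [Fintype S₁] [Fintype T₁] [Fintype S₂] [Fintype T₂]
  [Fintype S₃] [Fintype T₃] [DecidableEq S₁] [DecidableEq T₁] [DecidableEq S₂] [DecidableEq T₂]
  [DecidableEq S₃] [DecidableEq T₃]

/-- The pair of bijections `jS`, `jT` is an isomorphism from `Γ₁` to `Γ₂`: the maps that it induces
on sets of blocks carry vertices to vertices, red edges to red edges and yellow edges to yellow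
edges. Here `e.finsetCongr.finsetCongr P` is the set of all images `e(B)` with `B ∈ P`. -/
def IsIso (Γ₁ : BicoloredGraph S₁ T₁) (Γ₂ : BicoloredGraph S₂ T₂) (jS : S₁ ≃ S₂) (jT : T₁ ≃ T₂) :
    Prop :=
  (jS.sumCongr jT).finsetCongr.finsetCongr Γ₁.V.parts = Γ₂.V.parts ∧
  jS.finsetCongr.finsetCongr Γ₁.ES.parts = Γ₂.ES.parts ∧
  jT.finsetCongr.finsetCongr Γ₁.ET.parts = Γ₂.ET.parts

theorem IsIso.refl (Γ : BicoloredGraph S₁ T₁) : IsIso Γ Γ (Equiv.refl S₁) (Equiv.refl T₁) := by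
  simp [IsIso]

theorem IsIso.symm {Γ₁ : BicoloredGraph S₁ T₁} {Γ₂ : BicoloredGraph S₂ T₂} {jS : S₁ ≃ S₂}
    {jT : T₁ ≃ T₂} (h : IsIso Γ₁ Γ₂ jS jT) : IsIso Γ₂ Γ₁ jS.symm jT.symm := by
  obtain ⟨h1, h2, h3⟩ := h
  refine ⟨?_, ?_, ?_⟩
  · rw [← h1, ← Equiv.sumCongr_symm, ← Equiv.finsetCongr_symm, ← Equiv.finsetCongr_symm,
      Equiv.symm_apply_apply]
  · rw [← h2, ← Equiv.finsetCongr_symm, ← Equiv.finsetCongr_symm, Equiv.symm_apply_apply]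
  · rw [← h3, ← Equiv.finsetCongr_symm, ← Equiv.finsetCongr_symm, Equiv.symm_apply_apply]

theorem IsIso.trans {Γ₁ : BicoloredGraph S₁ T₁} {Γ₂ : BicoloredGraph S₂ T₂}
    {Γ₃ : BicoloredGraph S₃ T₃} {jS : S₁ ≃ S₂} {jT : T₁ ≃ T₂} {kS : S₂ ≃ S₃} {kT : T₂ ≃ T₃}
    (h : IsIso Γ₁ Γ₂ jS jT) (h' : IsIso Γ₂ Γ₃ kS kT) :
    IsIso Γ₁ Γ₃ (jS.trans kS) (jT.trans kT) := by
  obtain ⟨h1, h2, h3⟩ := h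
  obtain ⟨h1', h2', h3'⟩ := h'
  refine ⟨?_, ?_, ?_⟩
  · rw [← h1', ← h1, ← Equiv.sumCongr_trans, ← Equiv.finsetCongr_trans,
      ← Equiv.finsetCongr_trans, Equiv.trans_apply]
  · rw [← h2', ← h2, ← Equiv.finsetCongr_trans, ← Equiv.finsetCongr_trans, Equiv.trans_apply]
  · rw [← h3', ← h3, ← Equiv.finsetCongr_trans, ← Equiv.finsetCongr_trans, Equiv.trans_apply]

end Iso

section Invariants

variable {S T : Type*} [Fintype S] [Fintype T] [DecidableEq S] [DecidableEq T]

/-- The automorphism group: all isomorphisms of `Γ` to itself, as a group of pairs of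
permutations. -/
def Aut (Γ : BicoloredGraph S T) : Subgroup (Equiv.Perm S × Equiv.Perm T) where
  carrier := {j | IsIso Γ Γ j.1 j.2}
  one_mem' := IsIso.refl Γ
  mul_mem' := fun ha hb => IsIso.trans hb ha
  inv_mem' := fun ha => IsIso.symm ha

/-- The bidegree of a vertex: its number of red half-edges and its number of yellow half-edges. -/
def bidegree (v : Finset (S ⊕ T)) : ℕ × ℕ := (v.toLeft.card, v.toRight.card)

/-- The Euler characteristic: the number of vertices minus the number of edges. -/
def eulerChar (Γ : BicoloredGraph S T) : ℤ :=
  (Γ.V.parts.card : ℤ) - ((Γ.ES.parts.card : ℤ) + (Γ.ET.parts.card : ℤ))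

/-- All vertices have degree at least `3`. -/
def MinDegreeThree (Γ : BicoloredGraph S T) : Prop :=
  ∀ v ∈ Γ.V.parts, 3 ≤ (bidegree v).1 + (bidegree v).2

/-- The weight `(1 / |Aut Γ|) ∏_v Λ_{deg v}`. -/
noncomputable def weight (Λ : ℕ → ℕ → ℝ) (Γ : BicoloredGraph S T) : ℝ :=
  (1 / (Nat.card Γ.Aut : ℝ)) * ∏ v ∈ Γ.V.parts, Λ (bidegree v).1 (bidegree v).2

end Invariants

/-- Edge-bicolored graphs, with the half-edges of either colour numbered. Every graph on finite
label sets is isomorphic to one of these, see `exists_isIso_numbered`. -/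
abbrev Numbered : Type := Σ p : ℕ × ℕ, BicoloredGraph (Fin p.1) (Fin p.2)

/-- Transport of a set partition along a bijection. -/
def mapPartition {α β : Type*} [Fintype α] [Fintype β] [DecidableEq α] [DecidableEq β]
    (e : α ≃ β) (P : Finpartition (Finset.univ : Finset α)) :
    Finpartition (Finset.univ : Finset β) where
  parts := e.finsetCongr.finsetCongr P.parts
  supIndep := by
    rw [Finset.supIndep_iff_pairwiseDisjoint]
    intro a ha b hb hab
    simp only [Equiv.finsetCongr_apply, Finset.coe_map, Set.mem_image, Finset.mem_coe,
      Equiv.coe_toEmbedding] at ha hb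
    obtain ⟨a, ha, rfl⟩ := ha
    obtain ⟨b, hb, rfl⟩ := hb
    have : a ≠ b := fun h => hab (by rw [h])
    simpa [Function.onFun] using P.disjoint ha hb this
  sup_parts := by
    ext x
    have h := Finset.mem_univ (e.symm x)
    rw [← P.sup_parts] at h
    simp only [Finset.mem_sup, id] at h ⊢
    obtain ⟨b, hb, hx⟩ := h
    simp only [Finset.mem_univ, iff_true]
    exact ⟨e.finsetCongr b, Finset.mem_map_of_mem _ hb, by simpa [Finset.mem_map_equiv] using hx⟩
  bot_notMem := by
    simp only [Equiv.finsetCongr_apply, Finset.bot_eq_empty, Finset.mem_map,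
      Equiv.coe_toEmbedding, Finset.map_eq_empty, not_exists, not_and]
    intro x hx hx'
    subst hx'
    exact P.bot_notMem hx

theorem exists_isIso_numbered {S T : Type*} [Fintype S] [Fintype T] [DecidableEq S]
    [DecidableEq T] (Γ : BicoloredGraph S T) :
    ∃ (Γ' : Numbered) (jS : S ≃ Fin Γ'.1.1) (jT : T ≃ Fin Γ'.1.2), IsIso Γ Γ'.2 jS jT := by
  refine ⟨⟨(Fintype.card S, Fintype.card T),
    { V := mapPartition ((Fintype.equivFin S).sumCongr (Fintype.equivFin T)) Γ.V
      ES := mapPartition (Fintype.equivFin S) Γ.ES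
      ET := mapPartition (Fintype.equivFin T) Γ.ET
      card_ES := ?_
      card_ET := ?_ }⟩, Fintype.equivFin S, Fintype.equivFin T, rfl, rfl, rfl⟩
  · intro e he
    simp only [mapPartition, Equiv.finsetCongr_apply, Finset.mem_map, Equiv.coe_toEmbedding] at he
    obtain ⟨b, hb, rfl⟩ := he
    simpa using Γ.card_ES b hb
  · intro e he
    simp only [mapPartition, Equiv.finsetCongr_apply, Finset.mem_map, Equiv.coe_toEmbedding] at he
    obtain ⟨b, hb, rfl⟩ := he
    simpa using Γ.card_ET b hb

/-- Two graphs are equivalent when they are isomorphic. -/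
instance isoSetoid : Setoid Numbered where
  r Γ₁ Γ₂ := ∃ (jS : Fin Γ₁.1.1 ≃ Fin Γ₂.1.1) (jT : Fin Γ₁.1.2 ≃ Fin Γ₂.1.2),
    IsIso Γ₁.2 Γ₂.2 jS jT
  iseqv :=
    { refl := fun Γ => ⟨_, _, IsIso.refl Γ.2⟩
      symm := fun ⟨_, _, h⟩ => ⟨_, _, h.symm⟩
      trans := fun ⟨_, _, h⟩ ⟨_, _, h'⟩ => ⟨_, _, h.trans h'⟩ }

/-- The set of isomorphism classes of edge-bicolored graphs (without isolated vertices). -/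
abbrev IsoClass : Type := Quotient isoSetoid

/-- The isomorphism classes of edge-bicolored graphs with all vertex degrees at least `3` and Euler
characteristic `-n`. These properties do not depend on the representative `G.out` of `G`. -/
noncomputable def graphsStar (n : ℕ) : Set IsoClass :=
  {G | G.out.2.MinDegreeThree ∧ G.out.2.eulerChar = -(n : ℤ)}

/-- The coefficient `A_n`, the sum of `(1 / |Aut G|) ∏_v Λ_{deg v}` over all `G ∈ graphsStar n`;
the summand does not depend on the representative `G.out` of `G`. -/
noncomputable def coeffA (Λ : ℕ → ℕ → ℝ) (n : ℕ) : ℝ :=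
  ∑ᶠ G ∈ graphsStar n, G.out.2.weight Λ

end BicoloredGraph

/-- The integral `I(z) = z / (2π) ∫_D exp (z g(x,y)) dx dy`. -/
noncomputable def laplaceIntegral (D : Set (ℝ × ℝ)) (g : ℝ × ℝ → ℝ) (z : ℝ) : ℝ :=
  z / (2 * Real.pi) * ∫ p in D, Real.exp (z * g p)

/-- `f(z) ∼ ∑_{n ≥ 0} a_n z^{-n}` for large `z`: for all `R ≥ 0`,
`f(z) = ∑_{n < R} a_n z^{-n} + O(z^{-R})`. -/
def HasAsymptoticExpansion (f : ℝ → ℝ) (a : ℕ → ℝ) : Prop :=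
  ∀ R : ℕ, (fun z : ℝ => f z - ∑ n ∈ Finset.range R, a n * z ^ (-(n : ℤ)))
    =O[atTop] fun z : ℝ => z ^ (-(R : ℤ))

/-! Write `g = -(x² + y²)/2 + F` near the origin. The proof compares `I(z)` with a finite sum of
Gaussian moments and identifies these moments with labeled graphs.

Combinatorics. By orbit-stabilizer (`card_class_mul_card_aut`), a class with `s` red and `t` yellow
half-edges has `s! t! / |Aut|` numbered representatives. Hence `A_n` is a sum over numbered graphs
with weight `1/(s! t!)`. Such a graph is an independent choice of a vertex partition and of two
pairings. The partitions into `k` blocks, weighted by `Λ`, give the coefficients of `F^k / k!` (the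
exponential formula, `pow_sum_div_factorial_eq`). The pairings give the Gaussian moments
(`integral_pow_mul_exp`). The power of `z` is `z^k · z^(-(s+t)/2) = z^χ`. Degrees at least 3 force
`k ≤ 2n` and `s + t ≤ 6n`, so each `A_n` involves finitely many graphs.

Analysis. For order `R`, the exponential series of `z F` is cut at `k < 2R` and `F` is replaced by
its Taylor polynomial of degree below `6R`. On a small ball the error is at most a constant times
`z^(2R) ‖p‖^(6R)` times a Gaussian, since `F = O(‖p‖^3)` and `|F| ≤ ‖p‖²/4` costs only half of the
Gaussian exponent. After integration and normalization this is `O(z^(2R - 3R))`. Outside the ball,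
`exp (z g)` is exponentially small because `g ≤ c < 0`, and the tail of the perturbative integrand
is controlled by high moments (`laplaceIntegral_sub_perturbative_isBigO`). -/

/-! ### Counting maps by their fibres -/

section FiberCounting

variable {α ι : Type*} [Fintype α] [DecidableEq α] [Fintype ι] [DecidableEq ι]

/-- The number of functions with prescribed fibre cardinalities is a multinomial coefficient. -/
theorem prod_factorial_mul_card_fiber_eq (u : ι → ℕ) (hu : ∑ i, u i = Fintype.card α) :
    (∏ i, (u i).factorial) *
      (Finset.univ.filter fun f : α → ι => ∀ i, (Finset.univ.filter fun a => f a = i).card = u i).card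
      = (Fintype.card α).factorial := by
  obtain ⟨e⟩ : Nonempty (α ≃ Σ i, Fin (u i)) := by
    rw [← Fintype.card_eq]; simp [hu]
  set f₀ : α → ι := fun a => (e a).1 with hf₀
  have hfib (i : ι) : Fintype.card {a // f₀ a = i} = u i := by
    rw [Fintype.card_congr (e.subtypeEquiv (q := fun x => x.1 = i) (fun a => Iff.rfl)),
      Fintype.card_congr (Equiv.sigmaSubtype i), Fintype.card_fin]
  -- Permutations act transitively on the maps with these fibre sizes. Counting all `σ` by the value
  -- of `f₀ ∘ σ` therefore gives fibres that are all as large as the stabilizer of `f₀`, which has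
  -- order `∏ u_i!`.
  have key := Finset.card_eq_sum_card_fiberwise (s := (Finset.univ : Finset (Equiv.Perm α)))
    (f := fun σ : Equiv.Perm α => f₀ ∘ ⇑σ)
    (t := Finset.univ.filter fun f : α → ι => ∀ i, (Finset.univ.filter fun a => f a = i).card = u i)
    (by
      intro σ _
      simp only [Finset.coe_filter, Finset.mem_univ, true_and, Set.mem_ofPred_eq]
      intro i
      rw [← hfib i, ← Fintype.card_subtype]
      exact Fintype.card_congr (σ.subtypeEquiv fun a => Iff.rfl))
  rw [Finset.card_univ, Fintype.card_perm] at key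
  rw [key, Finset.sum_const_nat (m := ∏ i, (u i).factorial), mul_comm]
  intro f hf
  simp only [Finset.mem_filter, Finset.mem_univ, true_and] at hf
  have hcard (i : ι) : Fintype.card {a // f a = i} = Fintype.card {a // f₀ a = i} := by
    rw [hfib, Fintype.card_subtype, hf]
  let τ : Equiv.Perm α := Equiv.ofFiberEquiv (f := f) (g := f₀) fun i => Fintype.equivOfCardEq (hcard i)
  have hτ : f₀ ∘ τ = f := funext fun a => Equiv.ofFiberEquiv_map _ a
  have h1 := DomMulAct.stabilizer_card f₀
  simp_rw [hfib] at h1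
  rw [← h1, Fintype.card_subtype]
  refine Finset.card_bij (fun σ _ => σ * τ⁻¹) ?_ ?_ ?_
  · intro σ hσ
    simp only [Finset.mem_filter, Finset.mem_univ, true_and] at hσ ⊢
    funext a
    have := congrFun hσ (τ⁻¹ a)
    rw [← hτ] at this
    simpa using this
  · intro a _ b _ h
    simpa using h
  · intro σ hσ
    simp only [Finset.mem_filter, Finset.mem_univ, true_and] at hσ
    refine ⟨σ * τ, ?_, by simp⟩
    simp only [Finset.mem_filter, Finset.mem_univ, true_and]
    rw [Equiv.Perm.coe_mul, ← Function.comp_assoc, hσ, hτ]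

/-- Sums over functions to `Fin k` of products over the fibres are `k!` times sums over partitions
into `k` blocks. -/
theorem sum_prod_fiber_eq_factorial_mul_sum_finpartition (φ : Finset α → ℝ) (hφ : φ ∅ = 0) (k : ℕ) :
    ∑ c : α → Fin k, ∏ i, φ (Finset.univ.filter fun a => c a = i) =
      (k.factorial : ℝ) * ∑ P : {P : Finpartition (Finset.univ : Finset α) // P.parts.card = k},
        ∏ B ∈ P.1.parts, φ B := by
  -- A partition with its `k` blocks numbered is the same as a surjection to `Fin k`. Maps that miss
  -- a value contribute nothing because `φ ∅ = 0`, and each partition has `k!` numberings.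
  let A := Σ P : {P : Finpartition (Finset.univ : Finset α) // P.parts.card = k}, P.1.parts ≃ Fin k
  let G : A → (α → Fin k) := fun x a =>
    x.2 ⟨x.1.1.part a, x.1.1.part_mem.2 (Finset.mem_univ a)⟩
  have hG (x : A) (B : x.1.1.parts) : (Finset.univ.filter fun a => G x a = x.2 B) = B.1 := by
    ext a
    simp only [G, Finset.mem_filter, Finset.mem_univ, true_and, EmbeddingLike.apply_eq_iff_eq,
      Subtype.ext_iff]
    exact x.1.1.part_eq_iff_mem B.2
  have hprod (x : A) : ∏ i, φ (Finset.univ.filter fun a => G x a = i) = ∏ B ∈ x.1.1.parts, φ B := by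
    rw [← Equiv.prod_comp x.2, ← Finset.prod_coe_sort x.1.1.parts]
    exact Finset.prod_congr rfl fun B _ => by rw [hG]
  have hinj : Function.Injective G := by
    rintro ⟨⟨P, hP⟩, e⟩ ⟨⟨Q, hQ⟩, f⟩ h
    have hsub (B : P.parts) : ∃ C : Q.parts, f C = e B ∧ C.1 = B.1 := by
      refine ⟨f.symm (e B), by simp, ?_⟩
      have h1 := hG ⟨⟨P, hP⟩, e⟩ B
      have h2 := hG ⟨⟨Q, hQ⟩, f⟩ (f.symm (e B))
      rw [← h] at h2
      simp only [Equiv.apply_symm_apply] at h2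
      exact h2.symm.trans h1
    have hPQ : P = Q := by
      ext1
      refine Finset.eq_of_subset_of_card_le (fun B hB => ?_) (by rw [hP, hQ])
      obtain ⟨C, -, hC⟩ := hsub ⟨B, hB⟩
      exact (show C.1 = B from hC) ▸ C.2
    subst hPQ
    congr 1
    ext B
    obtain ⟨C, hC, hCB⟩ := hsub B
    rw [← hC, Subtype.ext hCB]
  have hsurj (c : α → Fin k) (hc : c ∉ Finset.univ.image G) :
      ∏ i, φ (Finset.univ.filter fun a => c a = i) = 0 := by
    by_contra hne
    have hsur : ∀ i, (Finset.univ.filter fun a => c a = i).Nonempty := by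
      intro i
      rw [Finset.nonempty_iff_ne_empty]
      intro h0
      exact hne (Finset.prod_eq_zero (Finset.mem_univ i) (by rw [h0, hφ]))
    apply hc
    have hfinj : Function.Injective fun i => Finset.univ.filter fun a => c a = i := by
      intro i j hij
      obtain ⟨a, ha⟩ := hsur i
      have hb : a ∈ Finset.univ.filter fun a => c a = j := by
        have : (Finset.univ.filter fun a => c a = i) = Finset.univ.filter fun a => c a = j := hij
        rwa [← this]
      simp only [Finset.mem_filter, Finset.mem_univ, true_and] at ha hb
      rw [← ha, hb]
    let P : Finpartition (Finset.univ : Finset α) := Finpartition.ofExistsUnique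
      (Finset.univ.image fun i => Finset.univ.filter fun a => c a = i)
      (fun _ _ => Finset.subset_univ _)
      (fun a _ => ⟨Finset.univ.filter fun b => c b = c a, by simp, by
        rintro _ ⟨hy, ha⟩
        simp only [Finset.mem_image, Finset.mem_univ, true_and] at hy
        obtain ⟨i, rfl⟩ := hy
        simp only [Finset.mem_filter, Finset.mem_univ, true_and] at ha
        rw [ha]⟩)
      (by
        simp only [Finset.mem_image, Finset.mem_univ, true_and, not_exists]
        intro i hi
        exact (hsur i).ne_empty hi)
    have hPc : P.parts.card = k := by
      simp only [P, Finpartition.ofExistsUnique]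
      rw [Finset.card_image_of_injective _ hfinj, Finset.card_univ, Fintype.card_fin]
    let e : Fin k ≃ P.parts := Equiv.ofBijective
      (fun i => ⟨Finset.univ.filter fun a => c a = i, by
        simp only [P, Finpartition.ofExistsUnique]
        exact Finset.mem_image_of_mem _ (Finset.mem_univ i)⟩)
      ⟨fun i j h => hfinj (congrArg Subtype.val h), by
        rintro ⟨B, hB⟩
        have hB' := hB
        simp only [P, Finpartition.ofExistsUnique, Finset.mem_image, Finset.mem_univ,
          true_and] at hB'
        obtain ⟨i, hi⟩ := hB'
        exact ⟨i, Subtype.ext hi⟩⟩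
    simp only [Finset.mem_image, Finset.mem_univ, true_and]
    refine ⟨⟨⟨P, hPc⟩, e.symm⟩, ?_⟩
    funext a
    simp only [G]
    rw [Equiv.symm_apply_eq]
    apply Subtype.ext
    exact P.part_eq_of_mem (e (c a)).2
      (show a ∈ Finset.univ.filter fun b => c b = c a by simp)
  rw [← Finset.sum_subset (Finset.subset_univ (Finset.univ.image G)) (fun c _ hc => hsurj c hc),
    Finset.sum_image hinj.injOn, Fintype.sum_sigma, Finset.mul_sum]
  refine Finset.sum_congr rfl fun P _ => ?_
  simp_rw [hprod]
  rw [Finset.sum_const, Finset.card_univ, nsmul_eq_mul,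
    Fintype.card_equiv (Fintype.equivFinOfCardEq (by simpa using P.2))]
  simp [P.2]

end FiberCounting

/-! ### The exponential formula in two variables -/

section ExponentialFormula

theorem sum_card_fiber_eq {α ι : Type*} [Fintype α] [DecidableEq α] [Fintype ι] [DecidableEq ι]
    (Φ : (ι → ℕ) → ℝ) :
    ∑ f : α → ι, Φ (fun i => (Finset.univ.filter fun a => f a = i).card) =
      ∑ u ∈ Finset.piAntidiag Finset.univ (Fintype.card α),
        ((Fintype.card α).factorial : ℝ) / (∏ i, ((u i).factorial : ℝ)) * Φ u := by
  rw [← Finset.sum_fiberwise_of_maps_to (s := Finset.univ)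
    (t := Finset.piAntidiag (Finset.univ : Finset ι) (Fintype.card α))
    (g := fun f : α → ι => fun i => (Finset.univ.filter fun a => f a = i).card)]
  · refine Finset.sum_congr rfl fun u hu => ?_
    rw [Finset.mem_piAntidiag] at hu
    have h := prod_factorial_mul_card_fiber_eq (α := α) u hu.1
    rw [Finset.sum_congr rfl (g := fun _ => Φ u)
      (fun f hf => by rw [(Finset.mem_filter.1 hf).2]), Finset.sum_const, nsmul_eq_mul]
    congr 1
    rw [eq_div_iff (by positivity), ← h]
    push_cast
    rw [mul_comm]
    congr 4
    ext f
    simp [funext_iff]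
  · intro f _
    simp only [Finset.mem_piAntidiag, Finset.mem_univ, implies_true, and_true]
    rw [← Finset.card_eq_sum_card_fiberwise (by simp), Finset.card_univ]

/-- The sum of `∏_v Λ_{deg v}` over the partitions of `Fin s ⊕ Fin t` into `k` blocks. -/
noncomputable def partitionSum (Λ : ℕ → ℕ → ℝ) (k s t : ℕ) : ℝ :=
  ∑ P : {P : Finpartition (Finset.univ : Finset (Fin s ⊕ Fin t)) // P.parts.card = k},
    ∏ B ∈ P.1.parts, Λ (BicoloredGraph.bidegree B).1 (BicoloredGraph.bidegree B).2

/-- Numbering the blocks turns a partition into one map to `Fin k` for each colour. The weight sees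
only the fibre sizes of the two maps, so multinomial coefficients count each colour separately. -/
theorem factorial_mul_partitionSum (Λ : ℕ → ℕ → ℝ) (h0 : Λ 0 0 = 0) (k s t : ℕ) :
    (k.factorial : ℝ) * partitionSum Λ k s t / ((s.factorial : ℝ) * (t.factorial : ℝ)) =
      ∑ u ∈ Finset.piAntidiag (Finset.univ : Finset (Fin k)) s,
        ∑ w ∈ Finset.piAntidiag (Finset.univ : Finset (Fin k)) t,
          ∏ i, (Λ (u i) (w i) / (((u i).factorial : ℝ) * ((w i).factorial : ℝ))) := by
  rw [partitionSum, ← sum_prod_fiber_eq_factorial_mul_sum_finpartition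
    (φ := fun B => Λ (BicoloredGraph.bidegree B).1 (BicoloredGraph.bidegree B).2)
    h0,
    ← Equiv.sum_comp (Equiv.sumArrowEquivProdArrow (Fin s) (Fin t) (Fin k)).symm,
    Fintype.sum_prod_type]
  have hb (f : Fin s → Fin k) (h : Fin t → Fin k) (i : Fin k) :
      BicoloredGraph.bidegree (Finset.univ.filter fun a =>
        (Equiv.sumArrowEquivProdArrow (Fin s) (Fin t) (Fin k)).symm (f, h) a = i) =
      ((Finset.univ.filter fun a => f a = i).card, (Finset.univ.filter fun a => h a = i).card) := by
    simp only [BicoloredGraph.bidegree, Prod.mk.injEq]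
    constructor <;> congr 1 <;> ext a
    · rw [Finset.mem_toLeft, Finset.mem_filter, Finset.mem_filter]
      simp [Equiv.sumArrowEquivProdArrow]
    · rw [Finset.mem_toRight, Finset.mem_filter, Finset.mem_filter]
      simp [Equiv.sumArrowEquivProdArrow]
  simp_rw [hb]
  have h1 := sum_card_fiber_eq (α := Fin s) (ι := Fin k) fun u =>
    ∑ w ∈ Finset.piAntidiag Finset.univ (Fintype.card (Fin t)),
        ((Fintype.card (Fin t)).factorial : ℝ) / (∏ i, ((w i).factorial : ℝ)) *
          ∏ i, Λ (u i) (w i)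
  simp_rw [fun f : Fin s → Fin k => sum_card_fiber_eq (α := Fin t) (ι := Fin k) fun w =>
    ∏ i, Λ ((Finset.univ.filter fun a => f a = i).card) (w i)]
  rw [h1]
  simp only [Fintype.card_fin]
  rw [Finset.sum_div]
  refine Finset.sum_congr rfl fun u _ => ?_
  rw [Finset.mul_sum, Finset.sum_div]
  refine Finset.sum_congr rfl fun w _ => ?_
  rw [Finset.prod_div_distrib, Finset.prod_mul_distrib]
  have := Nat.factorial_pos s
  have := Nat.factorial_pos t
  field_simp

/-- Powers of a bivariate polynomial, with coefficients in exponential normalization, as sums over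
set partitions. -/
theorem pow_sum_div_factorial_eq (Λ : ℕ → ℕ → ℝ) (h0 : Λ 0 0 = 0) (M : ℕ)
    (hM : ∀ u w, Λ u w ≠ 0 → u < M ∧ w < M) (k N : ℕ)
    (hN : k * M < N) (x y : ℝ) :
    (∑ m ∈ Finset.range M ×ˢ Finset.range M,
        Λ m.1 m.2 * (x ^ m.1 * y ^ m.2 / ((m.1.factorial : ℝ) * (m.2.factorial : ℝ)))) ^ k /
      (k.factorial : ℝ) =
      ∑ p ∈ Finset.range N ×ˢ Finset.range N,
        partitionSum Λ k p.1 p.2 / ((p.1.factorial : ℝ) * (p.2.factorial : ℝ)) *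
          (x ^ p.1 * y ^ p.2) := by
  rw [div_eq_iff (by positivity), Finset.sum_mul]
  have hr (p : ℕ × ℕ) : partitionSum Λ k p.1 p.2 / ((p.1.factorial : ℝ) * (p.2.factorial : ℝ)) *
          (x ^ p.1 * y ^ p.2) * (k.factorial : ℝ) =
      ∑ q ∈ Finset.piAntidiag (Finset.univ : Finset (Fin k)) p.1 ×ˢ
        Finset.piAntidiag (Finset.univ : Finset (Fin k)) p.2,
        ∏ i, (Λ (q.1 i) (q.2 i) * (x ^ q.1 i * y ^ q.2 i /
          (((q.1 i).factorial : ℝ) * ((q.2 i).factorial : ℝ)))) := by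
    rw [Finset.sum_product]
    trans (k.factorial : ℝ) * partitionSum Λ k p.1 p.2 /
      ((p.1.factorial : ℝ) * (p.2.factorial : ℝ)) * (x ^ p.1 * y ^ p.2)
    · ring
    rw [factorial_mul_partitionSum Λ h0, Finset.sum_mul]
    refine Finset.sum_congr rfl fun u hu => ?_
    rw [Finset.sum_mul]
    refine Finset.sum_congr rfl fun w hw => ?_
    rw [Finset.mem_piAntidiag] at hu hw
    rw [← hu.1, ← hw.1, ← Finset.prod_pow_eq_pow_sum, ← Finset.prod_pow_eq_pow_sum,
      ← Finset.prod_mul_distrib, ← Finset.prod_mul_distrib]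
    exact Finset.prod_congr rfl fun i _ => by ring
  simp_rw [hr]
  rw [← Fin.prod_const, Finset.prod_univ_sum]
  -- The expanded power is grouped by total bidegree, which stays below `N` by `hN`. Index families
  -- that leave the box `B` have a vanishing factor by `hM`.
  set B := Fintype.piFinset fun _ : Fin k => Finset.range M ×ˢ Finset.range M with hB
  rw [← Finset.sum_fiberwise_of_maps_to
    (t := Finset.range N ×ˢ Finset.range N)
    (g := fun m : Fin k → ℕ × ℕ => (∑ i, (m i).1, ∑ i, (m i).2))]
  · refine Finset.sum_congr rfl fun p _ => ?_
    refine Finset.sum_of_injOn (fun m => (fun i => (m i).1, fun i => (m i).2)) ?_ ?_ ?_ ?_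
    · intro m _ m' _ h
      simp only [Prod.mk.injEq, funext_iff] at h
      exact funext fun i => Prod.ext (h.1 i) (h.2 i)
    · intro m hm
      have := (Finset.mem_filter.1 hm).2
      simp [← this]
    · rintro ⟨u, w⟩ hq hnot
      simp only [Finset.mem_product, Finset.mem_piAntidiag] at hq
      by_contra hne
      rw [← ne_eq, Finset.prod_ne_zero_iff] at hne
      apply hnot
      refine ⟨fun i => (u i, w i), ?_, rfl⟩
      simp only [hB, Finset.coe_filter, Set.mem_ofPred_eq, Fintype.mem_piFinset,
        Finset.mem_product, Finset.mem_range]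
      exact ⟨fun i => hM _ _ (left_ne_zero_of_mul (hne i (Finset.mem_univ i))),
        Prod.ext hq.1.1 hq.2.1⟩
    · intro m _
      rfl
  · intro m hm
    simp only [hB, Fintype.mem_piFinset, Finset.mem_product, Finset.mem_range] at hm
    simp only [Finset.mem_product, Finset.mem_range]
    constructor
    · refine lt_of_le_of_lt ?_ hN
      simpa using Finset.sum_le_card_nsmul Finset.univ (fun i => (m i).1) M fun i _ => (hm i).1.le
    · refine lt_of_le_of_lt ?_ hN
      simpa using Finset.sum_le_card_nsmul Finset.univ (fun i => (m i).2) M fun i _ => (hm i).2.le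

/-- The partition sum only depends on the weights of the bidegrees that can occur. -/
theorem partitionSum_congr {Λ Λ' : ℕ → ℕ → ℝ} {k s t : ℕ}
    (h : ∀ u w, u + w ≤ s + t → Λ u w = Λ' u w) : partitionSum Λ k s t = partitionSum Λ' k s t := by
  refine Finset.sum_congr rfl fun P _ => Finset.prod_congr rfl fun B _ => h _ _ ?_
  have := Finset.card_le_univ B
  rw [BicoloredGraph.bidegree, Finset.card_toLeft_add_card_toRight]
  simpa using this

/-- `k` blocks of size at least 3 do not fit into fewer than `3k` elements, so every product
contains a vanishing weight. -/
theorem partitionSum_eq_zero {Λ : ℕ → ℕ → ℝ} (h : ∀ u w, u + w < 3 → Λ u w = 0) {k s t : ℕ}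
    (hk : s + t < 3 * k) : partitionSum Λ k s t = 0 := by
  refine Finset.sum_eq_zero fun P _ => ?_
  by_contra hne
  rw [← ne_eq, Finset.prod_ne_zero_iff] at hne
  have h3 : ∀ B ∈ P.1.parts, 3 ≤ B.card := by
    intro B hB
    by_contra hlt
    refine hne B hB (h _ _ ?_)
    rw [BicoloredGraph.bidegree, Finset.card_toLeft_add_card_toRight]
    omega
  have h4 := Finset.card_nsmul_le_sum _ _ _ h3
  rw [P.1.sum_card_parts, P.2] at h4
  simp at h4
  omega

end ExponentialFormula

/-! ### Counting pairings -/

section Pairings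

/-- The number of partitions of a set with `s` elements into pairs. -/
def numPairings (s : ℕ) : ℕ :=
  Fintype.card {P : Finpartition (Finset.univ : Finset (Fin s)) // ∀ e ∈ P.parts, e.card = 2}

theorem two_mul_card_parts {s : ℕ} {P : Finpartition (Finset.univ : Finset (Fin s))}
    (hP : ∀ e ∈ P.parts, e.card = 2) : 2 * P.parts.card = s := by
  have h := P.sum_card_parts
  rw [Finset.sum_const_nat hP] at h
  simp at h
  omega

theorem numPairings_odd (k : ℕ) : numPairings (2 * k + 1) = 0 := by
  rw [numPairings, Fintype.card_eq_zero_iff]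
  exact ⟨fun P => by have := two_mul_card_parts P.2; omega⟩

/-- With the indicator of size 2 as block weight, only the fibre vector `(2, ..., 2)` survives, and
its multinomial coefficient is `(2k)! / 2^k`. -/
theorem numPairings_even (k : ℕ) :
    (numPairings (2 * k) : ℝ) = ((2 * k).factorial : ℝ) / (2 ^ k * (k.factorial : ℝ)) := by
  have h := sum_prod_fiber_eq_factorial_mul_sum_finpartition (α := Fin (2 * k))
    (fun B => if B.card = 2 then 1 else 0) (by simp) k
  have h2 := sum_card_fiber_eq (α := Fin (2 * k)) (ι := Fin k)
    fun u => ∏ i, if u i = 2 then (1 : ℝ) else 0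
  rw [h, Finset.sum_eq_single (fun _ => 2)] at h2
  · simp only [Finset.prod_ite_zero, Finset.prod_const_one] at h2
    rw [Finset.sum_boole] at h2
    rw [eq_div_iff (by positivity)]
    have hc : (Finset.univ.filter fun P : {P : Finpartition (Finset.univ : Finset (Fin (2 * k))) //
        P.parts.card = k} => ∀ i ∈ P.1.parts, i.card = 2).card = numPairings (2 * k) := by
      rw [numPairings, ← Fintype.card_subtype]
      refine Fintype.card_congr ⟨fun P => ⟨P.1.1, P.2⟩, fun P => ⟨⟨P.1, ?_⟩, P.2⟩, ?_, ?_⟩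
      · have := two_mul_card_parts P.2; omega
      · intro P; rfl
      · intro P; rfl
    rw [hc] at h2
    simp only [Finset.mem_univ, implies_true, if_true, Fintype.card_fin, Finset.prod_const,
      Finset.card_univ, Nat.factorial_two, mul_one] at h2
    push_cast at h2
    rw [eq_div_iff (by positivity)] at h2
    linarith
  · intro u _ hu
    obtain ⟨i, hi⟩ := Function.ne_iff.1 hu
    have h0 : ∏ i, (if u i = 2 then (1 : ℝ) else 0) = 0 :=
      Finset.prod_eq_zero (Finset.mem_univ i) (if_neg hi)
    rw [h0, mul_zero]
  · intro hn
    exact absurd (by simp [Finset.mem_piAntidiag, mul_comm]) hn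

end Pairings

/-! ### Isomorphism invariance and the passage to numbered graphs -/

namespace BicoloredGraph

theorem bidegree_finsetCongr {S₁ T₁ S₂ T₂ : Type*} (jS : S₁ ≃ S₂) (jT : T₁ ≃ T₂)
    (v : Finset (S₁ ⊕ T₁)) :
    bidegree ((jS.sumCongr jT).finsetCongr v) = bidegree v := by
  have h1 : ((jS.sumCongr jT).finsetCongr v).toLeft = jS.finsetCongr v.toLeft := by
    ext a
    simp [Finset.mem_map_equiv]
  have h2 : ((jS.sumCongr jT).finsetCongr v).toRight = jT.finsetCongr v.toRight := by
    ext a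
    simp [Finset.mem_map_equiv]
  rw [bidegree, bidegree, h1, h2]
  simp

section Transport

variable {S₁ T₁ S₂ T₂ : Type*} [Fintype S₁] [Fintype T₁] [Fintype S₂] [Fintype T₂]
  [DecidableEq S₁] [DecidableEq T₁] [DecidableEq S₂] [DecidableEq T₂]
  {Γ₁ : BicoloredGraph S₁ T₁} {Γ₂ : BicoloredGraph S₂ T₂} {jS : S₁ ≃ S₂} {jT : T₁ ≃ T₂}

theorem IsIso.prod_eq (h : IsIso Γ₁ Γ₂ jS jT) (Λ : ℕ → ℕ → ℝ) :
    ∏ v ∈ Γ₂.V.parts, Λ (bidegree v).1 (bidegree v).2 =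
      ∏ v ∈ Γ₁.V.parts, Λ (bidegree v).1 (bidegree v).2 := by
  rw [← h.1, Equiv.finsetCongr_apply, Finset.prod_map]
  simp only [Equiv.coe_toEmbedding, bidegree_finsetCongr]

theorem IsIso.minDegreeThree (h : IsIso Γ₁ Γ₂ jS jT) (hd : Γ₁.MinDegreeThree) :
    Γ₂.MinDegreeThree := by
  intro v hv
  rw [← h.1, Equiv.finsetCongr_apply, Finset.mem_map] at hv
  obtain ⟨u, hu, rfl⟩ := hv
  rw [Equiv.coe_toEmbedding, bidegree_finsetCongr]
  exact hd u hu

theorem IsIso.eulerChar_eq (h : IsIso Γ₁ Γ₂ jS jT) : Γ₂.eulerChar = Γ₁.eulerChar := by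
  simp [eulerChar, ← h.1, ← h.2.1, ← h.2.2]

/-- Two graphs on the same half-edges with the same blocks are equal. -/
theorem ext_parts {Γ Γ' : BicoloredGraph S₁ T₁} (h1 : Γ.V.parts = Γ'.V.parts)
    (h2 : Γ.ES.parts = Γ'.ES.parts) (h3 : Γ.ET.parts = Γ'.ET.parts) : Γ = Γ' := by
  cases Γ
  cases Γ'
  rw [mk.injEq]
  exact ⟨Finpartition.ext h1, Finpartition.ext h2, Finpartition.ext h3⟩

/-- Transport of a graph along bijections of its half-edges. -/
def map (jS : S₁ ≃ S₂) (jT : T₁ ≃ T₂) (Γ : BicoloredGraph S₁ T₁) : BicoloredGraph S₂ T₂ where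
  V := mapPartition (jS.sumCongr jT) Γ.V
  ES := mapPartition jS Γ.ES
  ET := mapPartition jT Γ.ET
  card_ES := by
    intro e he
    simp only [mapPartition, Equiv.finsetCongr_apply, Finset.mem_map, Equiv.coe_toEmbedding] at he
    obtain ⟨b, hb, rfl⟩ := he
    simpa using Γ.card_ES b hb
  card_ET := by
    intro e he
    simp only [mapPartition, Equiv.finsetCongr_apply, Finset.mem_map, Equiv.coe_toEmbedding] at he
    obtain ⟨b, hb, rfl⟩ := he
    simpa using Γ.card_ET b hb

theorem isIso_iff_map_eq : IsIso Γ₁ Γ₂ jS jT ↔ Γ₁.map jS jT = Γ₂ :=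
  ⟨fun h => ext_parts h.1 h.2.1 h.2.2, fun h => h ▸ ⟨rfl, rfl, rfl⟩⟩

end Transport

section Counting

variable {S T : Type*} [Fintype S] [Fintype T] [DecidableEq S] [DecidableEq T]

/-- A graph is a vertex partition together with a pairing of either set of half-edges. -/
def equivProd : BicoloredGraph S T ≃ Finpartition (Finset.univ : Finset (S ⊕ T)) ×
    {P : Finpartition (Finset.univ : Finset S) // ∀ e ∈ P.parts, e.card = 2} ×
    {P : Finpartition (Finset.univ : Finset T) // ∀ e ∈ P.parts, e.card = 2} where
  toFun Γ := (Γ.V, ⟨Γ.ES, Γ.card_ES⟩, ⟨Γ.ET, Γ.card_ET⟩)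
  invFun x := ⟨x.1, x.2.1.1, x.2.2.1, x.2.1.2, x.2.2.2⟩
  left_inv _ := rfl
  right_inv _ := rfl

instance : Fintype (BicoloredGraph S T) := Fintype.ofEquiv _ equivProd.symm

instance (Γ : BicoloredGraph S T) : Decidable Γ.MinDegreeThree :=
  inferInstanceAs (Decidable (∀ v ∈ Γ.V.parts, _))

theorem two_mul_eulerChar {s t : ℕ} (Γ : BicoloredGraph (Fin s) (Fin t)) :
    2 * Γ.eulerChar = 2 * Γ.V.parts.card - (s + t : ℤ) := by
  have h1 := two_mul_card_parts Γ.card_ES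
  have h2 := two_mul_card_parts Γ.card_ET
  rw [eulerChar]
  omega

theorem MinDegreeThree.three_mul_card_le {s t : ℕ} {Γ : BicoloredGraph (Fin s) (Fin t)}
    (h : Γ.MinDegreeThree) : 3 * Γ.V.parts.card ≤ s + t := by
  have h3 : ∀ B ∈ Γ.V.parts, 3 ≤ B.card := by
    intro B hB
    have := h B hB
    rwa [bidegree, Finset.card_toLeft_add_card_toRight] at this
  have h4 := Finset.card_nsmul_le_sum _ _ _ h3
  rw [Γ.V.sum_card_parts] at h4
  simp at h4
  omega

open Classical in
/-- Orbit-stabilizer theorem for the relabelings of a graph. -/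
theorem card_class_mul_card_aut (X : Finset Numbered) (Γ : Numbered)
    (hX : ∀ Γ' : Numbered, Γ ≈ Γ' → Γ' ∈ X) :
    (X.filter fun Γ' => Γ ≈ Γ').card * Nat.card Γ.2.Aut =
      Γ.1.1.factorial * Γ.1.2.factorial := by
  obtain ⟨⟨s, t⟩, γ⟩ := Γ
  let f : Equiv.Perm (Fin s) × Equiv.Perm (Fin t) → Numbered :=
    fun σ => ⟨(s, t), γ.map σ.1 σ.2⟩
  have key := Finset.card_eq_sum_card_fiberwise
    (s := (Finset.univ : Finset (Equiv.Perm (Fin s) × Equiv.Perm (Fin t)))) (f := f)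
    (t := X.filter fun Γ' => (⟨(s, t), γ⟩ : Numbered) ≈ Γ')
    (by
      intro σ _
      have h : (⟨(s, t), γ⟩ : Numbered) ≈ f σ := ⟨σ.1, σ.2, isIso_iff_map_eq.2 rfl⟩
      simpa using ⟨hX _ h, h⟩)
  rw [Finset.card_univ, Fintype.card_prod, Fintype.card_perm, Fintype.card_perm,
    Fintype.card_fin, Fintype.card_fin] at key
  rw [key, Finset.sum_const_nat]
  intro Γ' hΓ'
  obtain ⟨-, hiso⟩ := Finset.mem_filter.1 hΓ'
  obtain ⟨⟨s', t'⟩, γ'⟩ := Γ'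
  obtain ⟨τS, τT, hτ⟩ := hiso
  dsimp only at τS τT hτ
  obtain rfl : s = s' := by simpa using Fintype.card_congr τS
  obtain rfl : t = t' := by simpa using Fintype.card_congr τT
  have hf (σ : Equiv.Perm (Fin s) × Equiv.Perm (Fin t)) :
      f σ = ⟨(s, t), γ'⟩ ↔ IsIso γ γ' σ.1 σ.2 := by
    rw [isIso_iff_map_eq]
    simp [f]
  simp_rw [hf]
  rw [← Fintype.card_subtype, ← Nat.card_eq_fintype_card]
  -- Composition with the inverse of the fixed isomorphism `(τS, τT)` identifies the isomorphisms
  -- from `γ` to `γ'` with the automorphisms of `γ`.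
  refine Nat.card_congr
    ⟨fun σ => ⟨(σ.1.1.trans τS.symm, σ.1.2.trans τT.symm), σ.2.trans hτ.symm⟩,
      fun σ => ⟨(σ.1.1.trans τS, σ.1.2.trans τT), IsIso.trans (show IsIso γ γ _ _ from σ.2) hτ⟩,
      fun σ => ?_, fun σ => ?_⟩ <;>
  · apply Subtype.ext
    ext x <;> simp

/-- The graphs with numbered half-edges, all vertex degrees at least `3` and Euler characteristic
`-n` with less than `N` half-edges of either colour. -/
def starFinset (n N : ℕ) : Finset Numbered :=
  (Finset.range N ×ˢ Finset.range N).sigma fun _ =>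
    Finset.univ.filter fun γ => γ.MinDegreeThree ∧ γ.eulerChar = -(n : ℤ)

/-- With `v` vertices and `h` half-edges, `3v ≤ h` and `h = 2v + 2n` give `h ≤ 6n`. The bound `N`
thus excludes no graph. -/
theorem mem_starFinset {n N : ℕ} (hN : 6 * n < N) {Γ : Numbered} :
    Γ ∈ starFinset n N ↔ Γ.2.MinDegreeThree ∧ Γ.2.eulerChar = -(n : ℤ) := by
  simp only [starFinset, Finset.mem_sigma, Finset.mem_product, Finset.mem_range,
    Finset.mem_filter, Finset.mem_univ, true_and, and_iff_right_iff_imp, and_imp]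
  intro h1 h2
  have h3 := h1.three_mul_card_le
  have h4 := two_mul_eulerChar Γ.2
  omega

theorem mem_starFinset_of_equiv {n N : ℕ} (hN : 6 * n < N) {Γ Γ' : Numbered} (h : Γ ≈ Γ')
    (hΓ : Γ ∈ starFinset n N) : Γ' ∈ starFinset n N := by
  obtain ⟨jS, jT, hj⟩ := h
  rw [mem_starFinset hN] at hΓ ⊢
  exact ⟨hj.minDegreeThree hΓ.1, hj.eulerChar_eq.trans hΓ.2⟩

theorem mem_graphsStar_iff {n N : ℕ} (hN : 6 * n < N) {G : IsoClass} :
    G ∈ graphsStar n ↔ G.out ∈ starFinset n N := by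
  rw [mem_starFinset hN]
  rfl

theorem mk_mem_graphsStar {n N : ℕ} (hN : 6 * n < N) {Γ : Numbered} (hΓ : Γ ∈ starFinset n N) :
    (Quotient.mk isoSetoid Γ) ∈ graphsStar n := by
  rw [mem_graphsStar_iff hN]
  exact mem_starFinset_of_equiv hN (Setoid.symm (Quotient.mk_out Γ)) hΓ

theorem graphsStar_finite (n : ℕ) : (graphsStar n).Finite := by
  have hN : 6 * n < 6 * n + 1 := Nat.lt_succ_self _
  refine ((starFinset n (6 * n + 1)).finite_toSet.image (Quotient.mk isoSetoid)).subset ?_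
  intro G hG
  exact ⟨G.out, (mem_graphsStar_iff hN).1 hG, Quotient.out_eq G⟩

/-- The sum over isomorphism classes as a sum over labeled graphs. -/
theorem coeffA_eq_sum_starFinset (Λ : ℕ → ℕ → ℝ) {n N : ℕ} (hN : 6 * n < N) :
    coeffA Λ n = ∑ Γ ∈ starFinset n N,
      (∏ v ∈ Γ.2.V.parts, Λ (bidegree v).1 (bidegree v).2) /
        ((Γ.1.1.factorial : ℝ) * (Γ.1.2.factorial : ℝ)) := by
  classical
  -- Finiteness of `graphsStar n` ensures that the `finsum` is an ordinary sum and not the default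
  -- value 0.
  rw [coeffA, finsum_mem_eq_finite_toFinset_sum _ (graphsStar_finite n),
    ← Finset.sum_fiberwise_of_maps_to (s := starFinset n N) (g := Quotient.mk isoSetoid)
      (t := (graphsStar_finite n).toFinset)
      (fun Γ hΓ => (Set.Finite.mem_toFinset _).2 (mk_mem_graphsStar hN hΓ))]
  refine Finset.sum_congr rfl fun G hG => ?_
  rw [Set.Finite.mem_toFinset, mem_graphsStar_iff hN] at hG
  have hfil : ((starFinset n N).filter fun Γ => Quotient.mk isoSetoid Γ = G) =
      (starFinset n N).filter fun Γ => G.out ≈ Γ := by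
    refine Finset.filter_congr fun Γ _ => ?_
    rw [← Quotient.out_eq G, eq_comm, Quotient.eq, Quotient.out_eq]
  have hcard := card_class_mul_card_aut (starFinset n N) G.out
    fun Γ' h => mem_starFinset_of_equiv hN h hG
  rw [hfil, Finset.sum_congr rfl (g := fun _ =>
    (∏ v ∈ G.out.2.V.parts, Λ (bidegree v).1 (bidegree v).2) /
        ((G.out.1.1.factorial : ℝ) * (G.out.1.2.factorial : ℝ)))]
  · rw [Finset.sum_const, nsmul_eq_mul, weight]
    have hpos : (Nat.card G.out.2.Aut : ℝ) ≠ 0 := by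
      intro h0
      rw [Nat.cast_eq_zero.1 h0, mul_zero] at hcard
      exact (Nat.mul_pos (Nat.factorial_pos _) (Nat.factorial_pos _)).ne hcard
    have hc : (((starFinset n N).filter fun Γ => G.out ≈ Γ).card : ℝ) * Nat.card G.out.2.Aut =
      (G.out.1.1.factorial : ℝ) * (G.out.1.2.factorial : ℝ) := by exact_mod_cast hcard
    have h1 := Nat.factorial_pos G.out.1.1
    have h2 := Nat.factorial_pos G.out.1.2
    rw [← hc]
    have h3 : (((starFinset n N).filter fun Γ => G.out ≈ Γ).card : ℝ) ≠ 0 := by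
      intro h0
      rw [h0, zero_mul] at hc
      have : (0 : ℝ) < (G.out.1.1.factorial : ℝ) * (G.out.1.2.factorial : ℝ) := by positivity
      exact this.ne hc
    field_simp
  · intro Γ hΓ
    obtain ⟨jS, jT, hj⟩ := (Finset.mem_filter.1 hΓ).2
    have hs : G.out.1.1 = Γ.1.1 := by simpa using Fintype.card_congr jS
    have ht : G.out.1.2 = Γ.1.2 := by simpa using Fintype.card_congr jT
    rw [hj.prod_eq, show (Γ.1.1.factorial : ℝ) = G.out.1.1.factorial by rw [hs],
      show (Γ.1.2.factorial : ℝ) = G.out.1.2.factorial by rw [ht]]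

/-- The coefficient `A_n` in terms of pairings and sums over set partitions. -/
theorem coeffA_eq_sum_partitionSum (Λ : ℕ → ℕ → ℝ) {n N K : ℕ} (hN : 6 * n < N) (hK : 2 * n < K)
    (h3 : ∀ u w, u + w < 3 → Λ u w = 0) :
    coeffA Λ n = ∑ k ∈ Finset.range K, ∑ p ∈ Finset.range N ×ˢ Finset.range N,
      if p.1 + p.2 = 2 * (n + k) then partitionSum Λ k p.1 p.2 /
        ((p.1.factorial : ℝ) * (p.2.factorial : ℝ)) * (numPairings p.1 * numPairings p.2) else 0 := by
  rw [coeffA_eq_sum_starFinset Λ hN, starFinset, Finset.sum_sigma, Finset.sum_comm]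
  refine Finset.sum_congr rfl fun p _ => ?_
  obtain ⟨s, t⟩ := p
  dsimp only
  rw [← Finset.sum_div, Finset.sum_filter]
  -- Sorting by the number `k` of vertices turns the Euler characteristic into the condition `s + t
  -- = 2 (n + k)`. The degree condition can be dropped, since a vertex of degree below 3 makes the
  -- product vanish, and it forces `k ≤ 2n < K`.
  have hstep (γ : BicoloredGraph (Fin s) (Fin t)) :
      (if γ.MinDegreeThree ∧ γ.eulerChar = -(n : ℤ) then
        ∏ v ∈ γ.V.parts, Λ (bidegree v).1 (bidegree v).2 else 0) =
      ∑ k ∈ Finset.range K, if s + t = 2 * (n + k) then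
        if γ.V.parts.card = k then ∏ v ∈ γ.V.parts, Λ (bidegree v).1 (bidegree v).2 else 0
        else 0 := by
    have h4 := two_mul_eulerChar γ
    by_cases hd : γ.MinDegreeThree
    · have h5 := hd.three_mul_card_le
      by_cases he : γ.eulerChar = -(n : ℤ)
      · rw [if_pos ⟨hd, he⟩, Finset.sum_eq_single γ.V.parts.card]
        · rw [if_pos (by omega), if_pos rfl]
        · intro k _ hk
          rw [if_neg hk.symm, ite_self]
        · intro hk
          rw [Finset.mem_range] at hk
          omega
      · rw [if_neg fun h => he h.2, Finset.sum_eq_zero]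
        intro k _
        split_ifs with h6 h7
        · omega
        · rfl
        · rfl
    · rw [if_neg fun h => hd h.1, Finset.sum_eq_zero]
      intro k _
      have hz : ∏ v ∈ γ.V.parts, Λ (bidegree v).1 (bidegree v).2 = 0 := by
        simp only [MinDegreeThree, not_forall, not_le] at hd
        obtain ⟨v, hv, hlt⟩ := hd
        exact Finset.prod_eq_zero hv (h3 _ _ hlt)
      rw [hz, ite_self, ite_self]
  simp_rw [hstep]
  rw [Finset.sum_comm, Finset.sum_div]
  refine Finset.sum_congr rfl fun k _ => ?_
  split_ifs with hk
  · let φ (V : Finpartition (Finset.univ : Finset (Fin s ⊕ Fin t))) : ℝ :=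
      if V.parts.card = k then ∏ v ∈ V.parts, Λ (bidegree v).1 (bidegree v).2 else 0
    have hφ : ∑ γ : BicoloredGraph (Fin s) (Fin t), φ γ.V = ∑ V, φ V * (numPairings s * numPairings t) := by
      rw [← Equiv.sum_comp equivProd.symm, Fintype.sum_prod_type]
      refine Finset.sum_congr rfl fun V _ => ?_
      trans ∑ y : {P : Finpartition (Finset.univ : Finset (Fin s)) // ∀ e ∈ P.parts, e.card = 2} ×
        {P : Finpartition (Finset.univ : Finset (Fin t)) // ∀ e ∈ P.parts, e.card = 2}, φ V
      · rfl
      · rw [Finset.sum_const, Finset.card_univ, nsmul_eq_mul, Fintype.card_prod, numPairings,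
          numPairings]
        push_cast
        ring
    change (∑ γ : BicoloredGraph (Fin s) (Fin t), φ γ.V) / _ = _
    rw [hφ, ← Finset.sum_mul, ← Finset.sum_filter,
      Finset.sum_subtype _ (p := fun P => P.parts.card = k) (fun P => by simp)]
    simp only [partitionSum]
    ring
  · simp

end Counting

end BicoloredGraph

/-! ### Gaussian moments -/

section GaussianMoments

theorem integrable_pow_mul_exp_neg_mul_sq_div_two {z : ℝ} (hz : 0 < z) (s : ℕ) :
    Integrable fun x : ℝ => x ^ s * Real.exp (-(z * x ^ 2 / 2)) := by
  have h := integrable_rpow_mul_exp_neg_mul_sq (half_pos hz) (s := s)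
    (lt_of_lt_of_le neg_one_lt_zero (Nat.cast_nonneg s))
  refine h.congr (Eventually.of_forall fun x => ?_)
  simp only [Real.rpow_natCast]
  congr 2
  ring

/-- Integration by parts, with `x exp(-z x²/2)` as the derivative of `-exp(-z x²/2)/z`. Up to the
factor `1/z` this is the recursion `numPairings_add_two`. -/
theorem integral_pow_add_two_mul_exp {z : ℝ} (hz : 0 < z) (s : ℕ) :
    ∫ x : ℝ, x ^ (s + 2) * Real.exp (-(z * x ^ 2 / 2)) =
      ((s : ℝ) + 1) / z * ∫ x : ℝ, x ^ s * Real.exp (-(z * x ^ 2 / 2)) := by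
  have hu (x : ℝ) : HasDerivAt (fun x : ℝ => x ^ (s + 1)) (((s : ℝ) + 1) * x ^ s) x := by
    simpa using hasDerivAt_pow (s + 1) x
  have hv (x : ℝ) : HasDerivAt (fun x : ℝ => -(Real.exp (-(z * x ^ 2 / 2)) / z))
      (x * Real.exp (-(z * x ^ 2 / 2))) x := by
    have h1 : HasDerivAt (fun x : ℝ => -(z * x ^ 2 / 2)) (-(z * x)) x := by
      have h := (((hasDerivAt_pow 2 x).const_mul z).div_const 2).neg
      refine h.congr_deriv ?_
      simp
      ring
    refine (h1.exp.div_const z).neg.congr_deriv ?_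
    field_simp
  have hint := integral_mul_deriv_eq_deriv_mul_of_integrable (u := fun x : ℝ => x ^ (s + 1))
    (v := fun x : ℝ => -(Real.exp (-(z * x ^ 2 / 2)) / z)) (fun x _ => hu x) (fun x _ => hv x)
    ((integrable_pow_mul_exp_neg_mul_sq_div_two hz (s + 2)).congr
      (Eventually.of_forall fun x => by simp only [Pi.mul_apply]; ring))
    (((integrable_pow_mul_exp_neg_mul_sq_div_two hz s).const_mul (-((s + 1) / z))).congr
      (Eventually.of_forall fun x => by simp only [Pi.mul_apply]; ring))
    (((integrable_pow_mul_exp_neg_mul_sq_div_two hz (s + 1)).const_mul (-(1 / z))).congr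
      (Eventually.of_forall fun x => by simp only [Pi.mul_apply]; ring))
  rw [show (fun x : ℝ => x ^ (s + 2) * Real.exp (-(z * x ^ 2 / 2))) =
    fun x => x ^ (s + 1) * (x * Real.exp (-(z * x ^ 2 / 2))) from funext fun x => by ring, hint,
    ← integral_const_mul, ← integral_neg]
  congr 1
  funext x
  ring

theorem numPairings_add_two (k : ℕ) :
    (numPairings (2 * (k + 1)) : ℝ) = (2 * k + 1) * numPairings (2 * k) := by
  rw [numPairings_even, numPairings_even, show 2 * (k + 1) = 2 * k + 1 + 1 by ring,
    Nat.factorial_succ, Nat.factorial_succ, Nat.factorial_succ]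
  push_cast
  field_simp
  ring

/-- The moments of the centered Gaussian of variance `1 / z` count pairings. -/
theorem integral_pow_mul_exp {z : ℝ} (hz : 0 < z) (s : ℕ) :
    ∫ x : ℝ, x ^ s * Real.exp (-(z * x ^ 2 / 2)) =
      √(2 * Real.pi / z) * (numPairings s * (√z)⁻¹ ^ s) := by
  obtain ⟨k, rfl | rfl⟩ := Nat.even_or_odd' s
  · induction k with
    | zero =>
      have h := integral_gaussian (z / 2)
      rw [numPairings_even]
      simp only [mul_zero, pow_zero, one_mul, Nat.factorial_zero, Nat.cast_one, mul_one, div_one]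
      rw [show 2 * Real.pi / z = Real.pi / (z / 2) by field_simp, ← h]
      congr 1
      funext x
      congr 1
      ring
    | succ k ih =>
      rw [show 2 * (k + 1) = 2 * k + 2 by ring, integral_pow_add_two_mul_exp hz, ih,
        show 2 * k + 2 = 2 * (k + 1) by ring, numPairings_add_two,
        show 2 * (k + 1) = 2 * k + 2 by ring, pow_add, inv_pow (√z) 2, Real.sq_sqrt hz.le]
      push_cast
      ring
  · rw [numPairings_odd]
    -- The integrand is odd, so its integral equals its own negative.
    have h := integral_neg_eq_self (fun x : ℝ => x ^ (2 * k + 1) * Real.exp (-(z * x ^ 2 / 2))) volume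
    simp only [Odd.neg_pow ⟨k, rfl⟩, even_two.neg_pow, neg_mul, integral_neg] at h
    rw [Nat.cast_zero, zero_mul, mul_zero]
    linarith

theorem exp_neg_mul_add_sq (z : ℝ) (p : ℝ × ℝ) :
    Real.exp (-(z * (p.1 ^ 2 + p.2 ^ 2) / 2)) =
      Real.exp (-(z * p.1 ^ 2 / 2)) * Real.exp (-(z * p.2 ^ 2 / 2)) := by
  rw [← Real.exp_add]
  congr 1
  ring

theorem integrable_monomial_mul_exp {z : ℝ} (hz : 0 < z) (s t : ℕ) :
    Integrable fun p : ℝ × ℝ => p.1 ^ s * p.2 ^ t * Real.exp (-(z * (p.1 ^ 2 + p.2 ^ 2) / 2)) := by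
  refine ((integrable_pow_mul_exp_neg_mul_sq_div_two hz s).mul_prod
    (integrable_pow_mul_exp_neg_mul_sq_div_two hz t)).congr (Eventually.of_forall fun p => ?_)
  simp only [exp_neg_mul_add_sq]
  ring

theorem integral_monomial_mul_exp {z : ℝ} (hz : 0 < z) (s t : ℕ) :
    z / (2 * Real.pi) *
        ∫ p : ℝ × ℝ, p.1 ^ s * p.2 ^ t * Real.exp (-(z * (p.1 ^ 2 + p.2 ^ 2) / 2)) =
      numPairings s * numPairings t * (√z)⁻¹ ^ (s + t) := by
  have h := integral_prod_mul (μ := (volume : Measure ℝ)) (ν := (volume : Measure ℝ))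
    (fun x : ℝ => x ^ s * Real.exp (-(z * x ^ 2 / 2)))
    (fun x : ℝ => x ^ t * Real.exp (-(z * x ^ 2 / 2)))
  rw [← Measure.volume_eq_prod] at h
  rw [show (fun p : ℝ × ℝ => p.1 ^ s * p.2 ^ t * Real.exp (-(z * (p.1 ^ 2 + p.2 ^ 2) / 2))) =
    fun p => (p.1 ^ s * Real.exp (-(z * p.1 ^ 2 / 2))) * (p.2 ^ t * Real.exp (-(z * p.2 ^ 2 / 2)))
    from funext fun p => by rw [exp_neg_mul_add_sq]; ring, h, integral_pow_mul_exp hz,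
    integral_pow_mul_exp hz]
  have hs : √(2 * Real.pi / z) * √(2 * Real.pi / z) = 2 * Real.pi / z :=
    Real.mul_self_sqrt (by positivity)
  have hpi := Real.pi_pos
  calc z / (2 * Real.pi) * (√(2 * Real.pi / z) * (numPairings s * (√z)⁻¹ ^ s) *
        (√(2 * Real.pi / z) * (numPairings t * (√z)⁻¹ ^ t)))
      = z / (2 * Real.pi) * (√(2 * Real.pi / z) * √(2 * Real.pi / z)) *
        (numPairings s * numPairings t * (√z)⁻¹ ^ (s + t)) := by ring
    _ = _ := by rw [hs]; field_simp

end GaussianMoments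

/-! ### Taylor remainder and error bounds near the origin -/

section LocalExpansion

/-- The coefficients of total degree less than `M`. -/
def truncateCoeff (Λ : ℕ → ℕ → ℝ) (M : ℕ) (u w : ℕ) : ℝ := if u + w < M then Λ u w else 0

/-- The polynomial with the given coefficients, in exponential normalization. -/
noncomputable def expPoly (Λ : ℕ → ℕ → ℝ) (M : ℕ) (p : ℝ × ℝ) : ℝ :=
  ∑ m ∈ Finset.range M ×ˢ Finset.range M,
    Λ m.1 m.2 * (p.1 ^ m.1 * p.2 ^ m.2 / ((m.1.factorial : ℝ) * (m.2.factorial : ℝ)))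

theorem abs_monomial_le (p : ℝ × ℝ) (u w : ℕ) : |p.1 ^ u * p.2 ^ w| ≤ ‖p‖ ^ (u + w) := by
  rw [abs_mul, abs_pow, abs_pow, pow_add]
  have h1 : |p.1| ≤ ‖p‖ := norm_fst_le p
  have h2 : |p.2| ≤ ‖p‖ := norm_snd_le p
  gcongr

/-- The norm is the maximum norm. Even powers dominate it by monomials without absolute values,
whose Gaussian integrals are known exactly. -/
theorem norm_pow_two_mul_le (p : ℝ × ℝ) (j : ℕ) :
    ‖p‖ ^ (2 * j) ≤ p.1 ^ (2 * j) + p.2 ^ (2 * j) := by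
  rw [Prod.norm_def]
  have h1 : 0 ≤ p.1 ^ (2 * j) := by rw [pow_mul]; positivity
  have h2 : 0 ≤ p.2 ^ (2 * j) := by rw [pow_mul]; positivity
  rcases max_choice ‖p.1‖ ‖p.2‖ with h | h <;> rw [h, Real.norm_eq_abs, pow_mul, sq_abs, ← pow_mul] <;>
    linarith

/-- The remainder of a bivariate power series that converges near the origin. -/
theorem exists_abs_sub_expPoly_le {Λ : ℕ → ℕ → ℝ} {F : ℝ × ℝ → ℝ}
    (hF : ∀ᶠ p in 𝓝 (0 : ℝ × ℝ), HasSum (fun m : ℕ × ℕ =>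
      Λ m.1 m.2 * (p.1 ^ m.1 * p.2 ^ m.2 / ((m.1.factorial : ℝ) * (m.2.factorial : ℝ)))) (F p)) :
    ∃ a > 0, ∀ M, ∃ C ≥ 0, ∀ p : ℝ × ℝ, ‖p‖ ≤ a →
      |F p - expPoly (truncateCoeff Λ M) M p| ≤ C * ‖p‖ ^ M := by
  obtain ⟨a, ha, hball⟩ := Metric.nhds_basis_closedBall.eventually_iff.1 hF
  have hna : ‖((a, a) : ℝ × ℝ)‖ = a := by simp [Prod.norm_def, abs_of_pos ha]
  -- Absolute convergence at the corner `(a, a)` suffices: each term of degree at least `M` at `p`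
  -- is at most `(‖p‖ / a)^M` times the absolute value of the same term at the corner. The radius
  -- `a` does not depend on `M`.
  have hsum := (hball (x := (a, a)) (by rw [mem_closedBall_zero_iff, hna])).summable.abs
  refine ⟨a, ha, fun M => ⟨(∑' m : ℕ × ℕ, |Λ m.1 m.2 * (a ^ m.1 * a ^ m.2 /
    ((m.1.factorial : ℝ) * (m.2.factorial : ℝ)))|) * (a ^ M)⁻¹,
    mul_nonneg (tsum_nonneg fun _ => abs_nonneg _) (by positivity), fun p hp => ?_⟩⟩
  have h1 := hball (x := p) (by rwa [mem_closedBall_zero_iff])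
  have h2 : HasSum (fun m : ℕ × ℕ => truncateCoeff Λ M m.1 m.2 *
      (p.1 ^ m.1 * p.2 ^ m.2 / ((m.1.factorial : ℝ) * (m.2.factorial : ℝ))))
      (expPoly (truncateCoeff Λ M) M p) := by
    refine hasSum_sum_of_ne_finset_zero fun m hm => ?_
    have : ¬ m.1 + m.2 < M := by
      intro h
      apply hm
      simp only [Finset.mem_product, Finset.mem_range]
      omega
    rw [truncateCoeff, if_neg this, zero_mul]
  rw [← Real.norm_eq_abs, mul_assoc]
  refine (h1.sub h2).norm_le_of_bounded (hsum.hasSum.mul_right _) fun m => ?_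
  rw [← sub_mul, truncateCoeff]
  split_ifs with hm
  · rw [sub_self, zero_mul, norm_zero]
    positivity
  · rw [sub_zero, Real.norm_eq_abs, abs_mul, abs_mul, abs_div, abs_div, mul_assoc]
    have h3 : |p.1 ^ m.1 * p.2 ^ m.2| ≤ |a ^ m.1 * a ^ m.2| * ((a ^ M)⁻¹ * ‖p‖ ^ M) := by
      refine (abs_monomial_le p _ _).trans ?_
      obtain ⟨d, hd⟩ := Nat.exists_eq_add_of_le (not_lt.1 hm)
      rw [← pow_add, hd, abs_of_pos (by positivity), pow_add, pow_add]
      have h4 : ‖p‖ ^ d ≤ a ^ d := by gcongr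
      calc ‖p‖ ^ M * ‖p‖ ^ d ≤ ‖p‖ ^ M * a ^ d := by gcongr
        _ = _ := by field_simp
    calc |Λ m.1 m.2| * (|p.1 ^ m.1 * p.2 ^ m.2| / |(m.1.factorial : ℝ) * (m.2.factorial : ℝ)|)
        ≤ |Λ m.1 m.2| * (|a ^ m.1 * a ^ m.2| * ((a ^ M)⁻¹ * ‖p‖ ^ M) /
          |(m.1.factorial : ℝ) * (m.2.factorial : ℝ)|) := by gcongr
      _ = _ := by ring

/-- A polynomial grows at most polynomially. -/
theorem exists_abs_expPoly_pow_le (Λ : ℕ → ℕ → ℝ) (M K : ℕ) {δ : ℝ} (hδ : 0 < δ) :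
    ∃ C ≥ 0, ∀ p : ℝ × ℝ, δ ≤ ‖p‖ → ∀ k ≤ K, |expPoly Λ M p| ^ k ≤ C * ‖p‖ ^ (2 * (M * K)) := by
  set A := 1 + ∑ m ∈ Finset.range M ×ˢ Finset.range M,
    |Λ m.1 m.2| / ((m.1.factorial : ℝ) * (m.2.factorial : ℝ)) with hA
  have hA1 : 1 ≤ A := le_add_of_nonneg_right (Finset.sum_nonneg fun _ _ => by positivity)
  have hA0 : 0 ≤ A := zero_le_one.trans hA1
  refine ⟨A ^ K * (1 / δ + 1) ^ (2 * (M * K)), by positivity, fun p hp k hk => ?_⟩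
  -- Rescaling makes the base at least 1, so that a single high power dominates all lower ones. The
  -- summand 1 in `A` serves the same purpose for the powers of `A`.
  have hq : 1 ≤ (1 / δ + 1) * ‖p‖ := by
    have : 1 ≤ 1 / δ * ‖p‖ := by rwa [one_div, ← div_eq_inv_mul, one_le_div hδ]
    nlinarith [norm_nonneg p]
  have hpq : ‖p‖ ≤ (1 / δ + 1) * ‖p‖ := by
    have : 0 ≤ 1 / δ * ‖p‖ := by positivity
    linarith
  have h1 : |expPoly Λ M p| ≤ A * ((1 / δ + 1) * ‖p‖) ^ (2 * M) := by
    rw [expPoly]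
    refine (Finset.abs_sum_le_sum_abs _ _).trans ?_
    rw [hA, add_mul, Finset.sum_mul]
    refine le_add_of_nonneg_of_le (by positivity) (Finset.sum_le_sum fun m hm => ?_)
    simp only [Finset.mem_product, Finset.mem_range] at hm
    rw [abs_mul, abs_div, abs_of_pos (a := (m.1.factorial : ℝ) * (m.2.factorial : ℝ)) (by positivity),
      div_mul_eq_mul_div, mul_div_assoc]
    gcongr
    calc _ ≤ ‖p‖ ^ (m.1 + m.2) := abs_monomial_le p _ _
      _ ≤ ((1 / δ + 1) * ‖p‖) ^ (m.1 + m.2) := by gcongr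
      _ ≤ _ := pow_le_pow_right₀ hq (by omega)
  calc |expPoly Λ M p| ^ k ≤ (A * ((1 / δ + 1) * ‖p‖) ^ (2 * M)) ^ k := by gcongr
    _ ≤ (A * ((1 / δ + 1) * ‖p‖) ^ (2 * M)) ^ K :=
        pow_le_pow_right₀ (one_le_mul_of_one_le_of_one_le hA1 (one_le_pow₀ hq)) hk
    _ = _ := by rw [mul_pow, ← pow_mul, mul_pow]; ring

theorem abs_exp_sub_sum_le (x : ℝ) (n : ℕ) :
    |Real.exp x - ∑ m ∈ Finset.range n, x ^ m / (m.factorial : ℝ)| ≤ |x| ^ n * Real.exp |x| := by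
  have h := Complex.norm_exp_sub_sum_le_norm_mul_exp (x : ℂ) n
  rw [Complex.norm_real, Real.norm_eq_abs] at h
  rw [← Real.norm_eq_abs, ← Complex.norm_real]
  push_cast
  exact h

/-- The integrand near the origin, compared with its perturbative expansion. -/
theorem exists_local_error_le {F P : ℝ × ℝ → ℝ} {δ C₁ C₂ b : ℝ} {K : ℕ} (hC₁ : 0 ≤ C₁)
    (hC₂ : 0 ≤ C₂)
    (hF : ∀ p, ‖p‖ ≤ δ → |F p| ≤ C₁ * ‖p‖ ^ 3) (hF' : ∀ p, ‖p‖ ≤ δ → |F p| ≤ ‖p‖ ^ 2 / 4)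
    (hb : ∀ p, ‖p‖ ≤ δ → |F p| ≤ b ∧ |P p| ≤ b)
    (hFP : ∀ p, ‖p‖ ≤ δ → |F p - P p| ≤ C₂ * ‖p‖ ^ (3 * K)) :
    ∃ C ≥ 0, ∀ z : ℝ, 1 ≤ z → ∀ p, ‖p‖ ≤ δ →
      |Real.exp (z * F p) - ∑ k ∈ Finset.range K, z ^ k * (P p ^ k / (k.factorial : ℝ))| *
        Real.exp (-(z * (p.1 ^ 2 + p.2 ^ 2) / 2)) ≤
      C * z ^ K * ‖p‖ ^ (3 * K) * Real.exp (-(z / 2 * (p.1 ^ 2 + p.2 ^ 2) / 2)) := by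
  have hB : 0 ≤ ∑ k ∈ Finset.range K, C₂ * (k * |b| ^ (k - 1)) :=
    Finset.sum_nonneg fun _ _ => by positivity
  refine ⟨C₁ ^ K + ∑ k ∈ Finset.range K, C₂ * (k * |b| ^ (k - 1)), by positivity,
    fun z hz p hp => ?_⟩
  have hz0 : 0 < z := by linarith
  have hr : ‖p‖ ^ 2 ≤ p.1 ^ 2 + p.2 ^ 2 := by simpa using norm_pow_two_mul_le p 1
  -- Taylor error of the exponential: `K` factors of `F` supply `‖p‖^(3K)`, and `exp |z F|` uses up
  -- half of the Gaussian exponent.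
  have h1 : |Real.exp (z * F p) - ∑ k ∈ Finset.range K, z ^ k * (F p ^ k / (k.factorial : ℝ))| ≤
      z ^ K * (C₁ ^ K * ‖p‖ ^ (3 * K)) * Real.exp (z * (p.1 ^ 2 + p.2 ^ 2) / 4) := by
    have h := abs_exp_sub_sum_le (z * F p) K
    simp_rw [mul_pow, mul_div_assoc] at h
    refine h.trans ?_
    rw [abs_mul, abs_of_pos hz0, mul_pow]
    have e1 : |F p| ^ K ≤ C₁ ^ K * ‖p‖ ^ (3 * K) := by
      rw [pow_mul, ← mul_pow]
      exact pow_le_pow_left₀ (abs_nonneg _) (hF p hp) K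
    have e2 : z * |F p| ≤ z * (p.1 ^ 2 + p.2 ^ 2) / 4 := by
      rw [mul_div_assoc]
      refine mul_le_mul_of_nonneg_left ((hF' p hp).trans ?_) hz0.le
      linarith
    gcongr
  -- Replacing `F` by `P`: a single factor `F - P` already supplies `‖p‖^(3K)`, and the remaining
  -- factors are bounded by `b`.
  have h2 : |∑ k ∈ Finset.range K, z ^ k * (F p ^ k / (k.factorial : ℝ)) -
      ∑ k ∈ Finset.range K, z ^ k * (P p ^ k / (k.factorial : ℝ))| ≤
      z ^ K * ((∑ k ∈ Finset.range K, C₂ * (k * |b| ^ (k - 1))) * ‖p‖ ^ (3 * K)) := by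
    rw [← Finset.sum_sub_distrib, Finset.sum_mul, Finset.mul_sum]
    refine (Finset.abs_sum_le_sum_abs _ _).trans (Finset.sum_le_sum fun k hk => ?_)
    rw [← mul_sub, ← sub_div, abs_mul, abs_of_pos (pow_pos hz0 k), abs_div, Nat.abs_cast]
    have hfac : (1 : ℝ) ≤ k.factorial := by exact_mod_cast Nat.factorial_pos k
    have e1 : |F p ^ k - P p ^ k| ≤ C₂ * ‖p‖ ^ (3 * K) * k * |b| ^ (k - 1) := by
      refine (abs_pow_sub_pow_le _ _ _).trans ?_
      have hm : max |F p| |P p| ≤ |b| := (max_le (hb p hp).1 (hb p hp).2).trans (le_abs_self b)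
      have := hFP p hp
      gcongr
    have e2 : |F p ^ k - P p ^ k| / (k.factorial : ℝ) ≤
        C₂ * (k * |b| ^ (k - 1)) * ‖p‖ ^ (3 * K) := by
      refine (div_le_self (abs_nonneg _) hfac).trans (e1.trans_eq ?_)
      ring
    have e3 : z ^ k ≤ z ^ K := pow_le_pow_right₀ hz (Finset.mem_range.1 hk).le
    gcongr
  have h3 : (1 : ℝ) ≤ Real.exp (z * (p.1 ^ 2 + p.2 ^ 2) / 4) := Real.one_le_exp (by positivity)
  have h4 := abs_sub_le (Real.exp (z * F p))
    (∑ k ∈ Finset.range K, z ^ k * (F p ^ k / (k.factorial : ℝ)))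
    (∑ k ∈ Finset.range K, z ^ k * (P p ^ k / (k.factorial : ℝ)))
  have h5 : |Real.exp (z * F p) - ∑ k ∈ Finset.range K, z ^ k * (P p ^ k / (k.factorial : ℝ))| ≤
      (C₁ ^ K + ∑ k ∈ Finset.range K, C₂ * (k * |b| ^ (k - 1))) * z ^ K * ‖p‖ ^ (3 * K) *
        Real.exp (z * (p.1 ^ 2 + p.2 ^ 2) / 4) := by
    refine h4.trans ((add_le_add h1 (h2.trans (le_mul_of_one_le_right (by positivity) h3))).trans_eq ?_)
    ring
  refine (mul_le_mul_of_nonneg_right h5 (Real.exp_pos _).le).trans_eq ?_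
  rw [mul_assoc, ← Real.exp_add]
  congr 2
  ring

end LocalExpansion

/-! ### The perturbative integral as a sum over graphs -/

section PerturbativeExpansion

/-- The integrand of the perturbative expansion, truncated at the order `K` of the exponential. -/
noncomputable def perturbativeIntegrand (P : ℝ × ℝ → ℝ) (K : ℕ) (z : ℝ) (p : ℝ × ℝ) : ℝ :=
  (∑ k ∈ Finset.range K, z ^ k * (P p ^ k / (k.factorial : ℝ))) *
    Real.exp (-(z * (p.1 ^ 2 + p.2 ^ 2) / 2))

theorem perturbativeIntegrand_eq {Λ : ℕ → ℕ → ℝ} (h0 : Λ 0 0 = 0) {M K N : ℕ}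
    (hM : ∀ u w, Λ u w ≠ 0 → u < M ∧ w < M) (hN : K * M < N) (z : ℝ) :
    perturbativeIntegrand (expPoly Λ M) K z = fun p =>
      ∑ k ∈ Finset.range K, ∑ q ∈ Finset.range N ×ˢ Finset.range N,
        z ^ k * (partitionSum Λ k q.1 q.2 / ((q.1.factorial : ℝ) * (q.2.factorial : ℝ))) *
          (p.1 ^ q.1 * p.2 ^ q.2 * Real.exp (-(z * (p.1 ^ 2 + p.2 ^ 2) / 2))) := by
  funext p
  rw [perturbativeIntegrand, Finset.sum_mul]
  refine Finset.sum_congr rfl fun k hk => ?_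
  have hkM : k * M < N :=
    (Nat.mul_le_mul_right M (Finset.mem_range.1 hk).le).trans_lt hN
  rw [expPoly, pow_sum_div_factorial_eq Λ h0 M hM k N hkM, Finset.mul_sum, Finset.sum_mul]
  exact Finset.sum_congr rfl fun q _ => by ring

theorem integrable_perturbativeIntegrand {Λ : ℕ → ℕ → ℝ} (h0 : Λ 0 0 = 0) {M K : ℕ}
    (hM : ∀ u w, Λ u w ≠ 0 → u < M ∧ w < M) {z : ℝ} (hz : 0 < z) :
    Integrable (perturbativeIntegrand (expPoly Λ M) K z) := by
  rw [perturbativeIntegrand_eq h0 hM (Nat.lt_succ_self _)]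
  exact integrable_finsetSum _ fun k _ => integrable_finsetSum _ fun q _ =>
    (integrable_monomial_mul_exp hz q.1 q.2).const_mul _

theorem integral_perturbativeIntegrand {Λ : ℕ → ℕ → ℝ} (h0 : Λ 0 0 = 0) {M K N : ℕ}
    (hM : ∀ u w, Λ u w ≠ 0 → u < M ∧ w < M) (hN : K * M < N) {z : ℝ} (hz : 0 < z) :
    z / (2 * Real.pi) * ∫ p, perturbativeIntegrand (expPoly Λ M) K z p =
      ∑ k ∈ Finset.range K, ∑ q ∈ Finset.range N ×ˢ Finset.range N,
        z ^ k * (partitionSum Λ k q.1 q.2 / ((q.1.factorial : ℝ) * (q.2.factorial : ℝ))) *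
          (numPairings q.1 * numPairings q.2 * (√z)⁻¹ ^ (q.1 + q.2)) := by
  rw [perturbativeIntegrand_eq h0 hM hN, integral_finsetSum _ fun k _ =>
    integrable_finsetSum _ fun q _ => (integrable_monomial_mul_exp hz q.1 q.2).const_mul _,
    Finset.mul_sum]
  refine Finset.sum_congr rfl fun k _ => ?_
  rw [integral_finsetSum _ fun q _ => (integrable_monomial_mul_exp hz q.1 q.2).const_mul _,
    Finset.mul_sum]
  refine Finset.sum_congr rfl fun q _ => ?_
  rw [integral_const_mul, ← integral_monomial_mul_exp hz]
  ring

/-- The perturbative integral agrees with the graphical expansion up to order `R`. -/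
theorem perturbative_sub_coeffA_isBigO {Λ : ℕ → ℕ → ℝ} (h3 : ∀ u w, u + w < 3 → Λ u w = 0)
    (R : ℕ) :
    (fun z : ℝ => z / (2 * Real.pi) * (∫ p, perturbativeIntegrand
        (expPoly (truncateCoeff Λ (6 * R)) (6 * R)) (2 * R) z p) -
      ∑ n ∈ Finset.range R, BicoloredGraph.coeffA Λ n * z ^ (-(n : ℤ)))
      =O[atTop] fun z : ℝ => z ^ (-(R : ℤ)) := by
  set Λt := truncateCoeff Λ (6 * R) with hΛt
  have ht3 : ∀ u w, u + w < 3 → Λt u w = 0 := fun u w h => by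
    rw [hΛt, truncateCoeff, h3 u w h, ite_self]
  have hM : ∀ u w, Λt u w ≠ 0 → u < 6 * R ∧ w < 6 * R := by
    intro u w h
    rw [hΛt, truncateCoeff, ite_ne_right_iff] at h
    omega
  set N := 2 * R * (6 * R) + 1 with hN
  let c (Λ : ℕ → ℕ → ℝ) (k : ℕ) (q : ℕ × ℕ) : ℝ :=
    partitionSum Λ k q.1 q.2 / ((q.1.factorial : ℝ) * (q.2.factorial : ℝ)) *
      (numPairings q.1 * numPairings q.2)
  have hterm (k : ℕ) (q : ℕ × ℕ) : (fun z : ℝ =>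
      c Λt k q * (z ^ k * (√z)⁻¹ ^ (q.1 + q.2)) -
      ∑ n ∈ Finset.range R, (if q.1 + q.2 = 2 * (n + k) then c Λ k q else 0) * z ^ (-(n : ℤ)))
      =O[atTop] fun z : ℝ => z ^ (-(R : ℤ)) := by
    -- If `s + t = 2 (d + k)`, the term has order `z^(-d)`, and `s + t ≥ 3k` means `k ≤ 2d`. For `d
    -- < R` this gives `s + t ≤ 6d < 6R`, so the truncation does not affect the coefficient. For `d
    -- ≥ R` the term is absorbed into the error.
    by_cases hq : ∃ d, q.1 + q.2 = 2 * (d + k) ∧ 3 * k ≤ q.1 + q.2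
    · obtain ⟨d, hd, hk⟩ := hq
      have hzd : (fun z : ℝ => z ^ k * (√z)⁻¹ ^ (q.1 + q.2)) =ᶠ[atTop]
          fun z : ℝ => z ^ (-(d : ℤ)) := by
        filter_upwards [eventually_gt_atTop 0] with z hz
        rw [hd, pow_mul, inv_pow, Real.sq_sqrt hz.le, inv_pow, pow_add, zpow_neg, zpow_natCast]
        field_simp
      by_cases hdR : d < R
      · refine (isBigO_zero _ _).congr' ?_ EventuallyEq.rfl
        filter_upwards [hzd] with z hz
        have hc : c Λt k q = c Λ k q := by
          simp only [c]
          rw [partitionSum_congr (Λ := Λt) (Λ' := Λ)]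
          intro u w huw
          rw [hΛt, truncateCoeff, if_pos (by omega)]
        rw [hz, Finset.sum_eq_single d, if_pos hd, hc, sub_self]
        · intro n _ hn
          rw [if_neg (by omega), zero_mul]
        · intro h
          exact absurd (Finset.mem_range.2 hdR) h
      · have h0 (z : ℝ) : ∑ n ∈ Finset.range R,
            (if q.1 + q.2 = 2 * (n + k) then c Λ k q else 0) * z ^ (-(n : ℤ)) = 0 := by
          refine Finset.sum_eq_zero fun n hn => ?_
          rw [Finset.mem_range] at hn
          rw [if_neg (by omega), zero_mul]
        simp_rw [h0, sub_zero]
        refine IsBigO.const_mul_left (hzd.trans_isBigO (IsBigO.of_bound 1 ?_)) _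
        filter_upwards [eventually_ge_atTop 1] with z hz
        rw [one_mul, Real.norm_of_nonneg (by positivity), Real.norm_of_nonneg (by positivity)]
        exact zpow_le_zpow_right₀ hz (by omega)
    -- Otherwise either the blocks do not fit or `s + t` is odd, in which case one colour has no
    -- pairing. Both coefficients vanish.
    · have hc (Λ' : ℕ → ℕ → ℝ) (h3' : ∀ u w, u + w < 3 → Λ' u w = 0)
          (h : q.1 + q.2 < 3 * k ∨ ∃ n, q.1 + q.2 = 2 * n + 1) : c Λ' k q = 0 := by
        simp only [c]
        rcases h with h | ⟨n, hn⟩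
        · rw [partitionSum_eq_zero h3' h, zero_div, zero_mul]
        · obtain ⟨a, ha | ha⟩ := Nat.even_or_odd' q.1
          · obtain ⟨b, hb | hb⟩ := Nat.even_or_odd' q.2
            · omega
            · rw [hb, numPairings_odd, Nat.cast_zero, mul_zero, mul_zero]
          · rw [ha, numPairings_odd, Nat.cast_zero, zero_mul, mul_zero]
      have hcase : q.1 + q.2 < 3 * k ∨ ∃ n, q.1 + q.2 = 2 * n + 1 := by
        by_contra hcon
        push Not at hcon
        refine hq ⟨(q.1 + q.2) / 2 - k, ?_, hcon.1⟩
        have := hcon.2 ((q.1 + q.2) / 2)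
        omega
      rw [hc Λt ht3 hcase, hc Λ h3 hcase]
      simp only [zero_mul, ite_self, Finset.sum_const_zero, sub_zero]
      exact isBigO_zero _ _
  have hsum := IsBigO.fun_sum (s := Finset.range (2 * R)) fun k _ =>
    IsBigO.fun_sum (s := Finset.range N ×ˢ Finset.range N) fun q _ => hterm k q
  refine hsum.congr' ?_ EventuallyEq.rfl
  filter_upwards [eventually_gt_atTop 0] with z hz
  rw [integral_perturbativeIntegrand (ht3 0 0 (by norm_num)) hM (N := N) (by omega) hz]
  simp only [Finset.sum_sub_distrib]
  congr 1
  · refine Finset.sum_congr rfl fun k _ => Finset.sum_congr rfl fun q _ => ?_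
    simp only [c]
    ring
  · have hA : ∀ n ∈ Finset.range R, BicoloredGraph.coeffA Λ n * z ^ (-(n : ℤ)) =
        ∑ k ∈ Finset.range (2 * R), ∑ q ∈ Finset.range N ×ˢ Finset.range N,
          (if q.1 + q.2 = 2 * (n + k) then c Λ k q else 0) * z ^ (-(n : ℤ)) := by
      intro n hn
      rw [Finset.mem_range] at hn
      rw [BicoloredGraph.coeffA_eq_sum_partitionSum Λ (N := N) (K := 2 * R)
        (by rw [hN]; nlinarith) (by omega) h3, Finset.sum_mul]
      exact Finset.sum_congr rfl fun k _ => by rw [Finset.sum_mul]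
    rw [Finset.sum_congr rfl hA]
    symm
    rw [Finset.sum_comm]
    refine Finset.sum_congr rfl fun k _ => ?_
    rw [Finset.sum_comm]

end PerturbativeExpansion

/-! ### Laplace's method -/

section LaplaceMethod

/-- The Gaussian has parameter `z/2`. The factor 4 comes from the two monomials and from normalizing
by `z` in place of `z/2`; the factor `2^j` comes from `(z/2)^(-j)`. -/
theorem integral_even_pow_mul_exp {z : ℝ} (hz : 0 < z) (j : ℕ) :
    z / (2 * Real.pi) * ∫ p : ℝ × ℝ, (p.1 ^ (2 * j) + p.2 ^ (2 * j)) *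
      Real.exp (-(z / 2 * (p.1 ^ 2 + p.2 ^ 2) / 2)) =
      4 * numPairings (2 * j) * 2 ^ j * (z ^ j)⁻¹ := by
  have h1 := integral_monomial_mul_exp (half_pos hz) (2 * j) 0
  have h2 := integral_monomial_mul_exp (half_pos hz) 0 (2 * j)
  have i1 := integrable_monomial_mul_exp (half_pos hz) (2 * j) 0
  have i2 := integrable_monomial_mul_exp (half_pos hz) 0 (2 * j)
  have hp0 : (numPairings 0 : ℝ) = 1 := by simpa using numPairings_even 0
  have hs : (√(z / 2))⁻¹ ^ (2 * j) = 2 ^ j * (z ^ j)⁻¹ := by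
    rw [pow_mul, inv_pow, Real.sq_sqrt (half_pos hz).le, inv_div, div_pow, div_eq_mul_inv]
  simp only [pow_zero, mul_one, one_mul, add_zero, zero_add, hp0, hs] at h1 h2 i1 i2
  simp_rw [add_mul]
  rw [integral_add i1 i2]
  linear_combination 2 * h1 + 2 * h2

theorem integrable_even_pow_mul_exp {z : ℝ} (hz : 0 < z) (j : ℕ) :
    Integrable fun p : ℝ × ℝ => (p.1 ^ (2 * j) + p.2 ^ (2 * j)) *
      Real.exp (-(z / 2 * (p.1 ^ 2 + p.2 ^ 2) / 2)) := by
  have i1 := integrable_monomial_mul_exp (half_pos hz) (2 * j) 0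
  have i2 := integrable_monomial_mul_exp (half_pos hz) 0 (2 * j)
  simp only [pow_zero, mul_one, one_mul] at i1 i2
  exact (i1.add i2).congr (Eventually.of_forall fun p => (add_mul _ _ _).symm)

theorem pow_mul_inv_pow_isBigO (c : ℝ) {R j : ℕ} (hj : 3 * R ≤ j) :
    (fun z : ℝ => c * (z ^ (2 * R) * (z ^ j)⁻¹)) =O[atTop] fun z : ℝ => z ^ (-(R : ℤ)) := by
  refine IsBigO.const_mul_left (IsBigO.of_bound 1 ?_) _
  filter_upwards [eventually_ge_atTop 1] with z hz
  have hz0 : 0 < z := by linarith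
  rw [one_mul, Real.norm_of_nonneg (by positivity), Real.norm_of_nonneg (by positivity),
    ← zpow_natCast, ← zpow_natCast, ← zpow_neg, ← zpow_add₀ hz0.ne']
  exact zpow_le_zpow_right₀ hz (by push_cast; omega)

theorem mul_exp_isBigO {c : ℝ} (hc : c < 0) (C : ℝ) (R : ℕ) :
    (fun z : ℝ => z / (2 * Real.pi) * (C * Real.exp ((z - 1) * c)))
      =O[atTop] fun z : ℝ => z ^ (-(R : ℤ)) := by
  have h := (isLittleO_exp_neg_mul_rpow_atTop (neg_pos.2 hc) (-(R : ℝ) - 1)).isBigO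
  have h2 := ((isBigO_refl (fun z : ℝ => z) atTop).mul h).const_mul_left
    (C * Real.exp (-c) / (2 * Real.pi))
  refine h2.congr' ?_ ?_
  · filter_upwards with z
    rw [show (z - 1) * c = -c + - -c * z by ring, Real.exp_add]
    ring
  · filter_upwards [eventually_gt_atTop 0] with z hz
    rw [Real.rpow_sub_one hz.ne', ← Real.rpow_intCast]
    push_cast
    field_simp

theorem laplaceIntegral_sub_perturbative_isBigO {D : Set (ℝ × ℝ)} {g : ℝ × ℝ → ℝ}
    {Λ : ℕ → ℕ → ℝ} (hD : NullMeasurableSet D volume)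
    (hint : ∀ z : ℝ, 0 < z → IntegrableOn (fun p => Real.exp (z * g p)) D volume)
    (hnhds : D ∈ 𝓝 (0 : ℝ × ℝ)) (h0 : g 0 = 0)
    (hsup : ∀ U ∈ 𝓝 (0 : ℝ × ℝ), ∃ c < g 0, ∀ p ∈ D \ U, g p ≤ c)
    (h3 : ∀ u w, u + w < 3 → Λ u w = 0)
    (hexp : ∀ᶠ p in 𝓝 (0 : ℝ × ℝ), HasSum (fun m : ℕ × ℕ =>
      Λ m.1 m.2 * (p.1 ^ m.1 * p.2 ^ m.2 / ((m.1.factorial : ℝ) * (m.2.factorial : ℝ))))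
        (g p - (-(p.1 ^ 2 / 2) - p.2 ^ 2 / 2))) (R : ℕ) :
    (fun z : ℝ => laplaceIntegral D g z - z / (2 * Real.pi) * (∫ p, perturbativeIntegrand
        (expPoly (truncateCoeff Λ (6 * R)) (6 * R)) (2 * R) z p))
      =O[atTop] fun z : ℝ => z ^ (-(R : ℤ)) := by
  set Λt := truncateCoeff Λ (6 * R) with hΛt
  set P := expPoly Λt (6 * R) with hP
  have ht3 : Λt 0 0 = 0 := by
    rw [hΛt, truncateCoeff, h3 0 0 (by norm_num), ite_self]
  have hM : ∀ u w, Λt u w ≠ 0 → u < 6 * R ∧ w < 6 * R := by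
    intro u w h
    rw [hΛt, truncateCoeff, ite_ne_right_iff] at h
    omega
  set F : ℝ × ℝ → ℝ := fun p => g p - (-(p.1 ^ 2 / 2) - p.2 ^ 2 / 2) with hF
  obtain ⟨a, ha, hrem⟩ := exists_abs_sub_expPoly_le hexp
  obtain ⟨C₁, hC₁, hF3⟩ := hrem 3
  obtain ⟨C₂, hC₂, hFP⟩ := hrem (6 * R)
  have hP3 (p : ℝ × ℝ) : expPoly (truncateCoeff Λ 3) 3 p = 0 := by
    refine Finset.sum_eq_zero fun m _ => ?_
    rw [truncateCoeff]
    split_ifs with h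
    · rw [h3 _ _ h, zero_mul]
    · rw [zero_mul]
  simp_rw [hP3, sub_zero] at hF3
  obtain ⟨r, hr, hrD⟩ := Metric.nhds_basis_closedBall.mem_iff.1 hnhds
  -- The ball must lie in `D` and in the domain of the remainder bounds. `C₁ δ ≤ 1/4` turns the
  -- cubic bound on `F` into `|F| ≤ ‖p‖²/4`, and `δ ≤ 1` makes `F` and `P` bounded by `1 + C₂`.
  obtain ⟨δ, hδ, hδa, hδr, hδC, hδ1⟩ : ∃ δ > 0, δ ≤ a ∧ δ ≤ r ∧ C₁ * δ ≤ 1 / 4 ∧ δ ≤ 1 := by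
    refine ⟨min (min a r) (min (1 / (4 * (C₁ + 1))) 1), by positivity, by simp, by simp, ?_,
      by simp⟩
    have : min (min a r) (min (1 / (4 * (C₁ + 1))) 1) ≤ 1 / (4 * (C₁ + 1)) :=
      (min_le_right _ _).trans (min_le_left _ _)
    calc _ ≤ C₁ * (1 / (4 * (C₁ + 1))) := by gcongr
      _ ≤ (C₁ + 1) * (1 / (4 * (C₁ + 1))) := by gcongr; linarith
      _ = 1 / 4 := by field_simp
  have hF2 (p : ℝ × ℝ) (hp : ‖p‖ ≤ δ) : |F p| ≤ ‖p‖ ^ 2 / 4 := by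
    calc |F p| ≤ C₁ * ‖p‖ ^ 3 := hF3 p (hp.trans hδa)
      _ = C₁ * ‖p‖ * ‖p‖ ^ 2 := by ring
      _ ≤ C₁ * δ * ‖p‖ ^ 2 := by gcongr
      _ ≤ 1 / 4 * ‖p‖ ^ 2 := by gcongr
      _ = _ := by ring
  have hb (p : ℝ × ℝ) (hp : ‖p‖ ≤ δ) : |F p| ≤ 1 + C₂ ∧ |P p| ≤ 1 + C₂ := by
    have e1 : ‖p‖ ≤ 1 := hp.trans hδ1
    have e2 : ‖p‖ ^ 2 ≤ 1 := pow_le_one₀ (norm_nonneg _) e1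
    have e3 := hF2 p hp
    have e4 : |F p - P p| ≤ C₂ := (hFP p (hp.trans hδa)).trans
      (mul_le_of_le_one_right hC₂ (pow_le_one₀ (norm_nonneg _) e1))
    refine ⟨by linarith, ?_⟩
    have e5 := abs_sub_abs_le_abs_sub (P p) (F p)
    rw [abs_sub_comm (P p) (F p)] at e5
    linarith
  obtain ⟨C, hC, hloc⟩ := exists_local_error_le (K := 2 * R) hC₁ hC₂
    (fun p hp => hF3 p (hp.trans hδa)) hF2 hb (fun p hp => by
      rw [show 3 * (2 * R) = 6 * R by ring]
      exact hFP p (hp.trans hδa))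
  obtain ⟨C', hC', hfar⟩ := exists_abs_expPoly_pow_le Λt (6 * R) (2 * R) hδ
  set L := 6 * R * (2 * R) with hL
  obtain ⟨c, hc, hgc⟩ := hsup _ (Metric.closedBall_mem_nhds (0 : ℝ × ℝ) hδ)
  rw [h0] at hc
  -- The three majorants bound the local error, the perturbative integrand outside the ball, and the
  -- original integrand outside the ball.
  have hpt (z : ℝ) (hz : 1 ≤ z) (p : ℝ × ℝ) :
      ‖D.indicator (fun p => Real.exp (z * g p)) p - perturbativeIntegrand P (2 * R) z p‖ ≤
      C * z ^ (2 * R) * ((p.1 ^ (2 * (3 * R)) + p.2 ^ (2 * (3 * R))) *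
        Real.exp (-(z / 2 * (p.1 ^ 2 + p.2 ^ 2) / 2))) +
      (2 * R : ℕ) * C' * z ^ (2 * R) * ((p.1 ^ (2 * L) + p.2 ^ (2 * L)) *
        Real.exp (-(z / 2 * (p.1 ^ 2 + p.2 ^ 2) / 2))) +
      D.indicator (fun p => Real.exp (1 * g p)) p * Real.exp ((z - 1) * c) := by
    have hz0 : 0 < z := by linarith
    have n1 := norm_pow_two_mul_le p (3 * R)
    have n2 := norm_pow_two_mul_le p L
    have n1' : 0 ≤ p.1 ^ (2 * (3 * R)) + p.2 ^ (2 * (3 * R)) := (by positivity : (0 : ℝ) ≤ _).trans n1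
    have n2' : 0 ≤ p.1 ^ (2 * L) + p.2 ^ (2 * L) := (by positivity : (0 : ℝ) ≤ _).trans n2
    have n3 : 0 ≤ D.indicator (fun p => Real.exp (1 * g p)) p :=
      Set.indicator_nonneg (fun _ _ => (Real.exp_pos _).le) _
    by_cases hp : ‖p‖ ≤ δ
    · have hpD : p ∈ D := hrD (by rw [mem_closedBall_zero_iff]; exact hp.trans hδr)
      rw [Set.indicator_of_mem hpD, perturbativeIntegrand,
        show z * g p = z * F p + -(z * (p.1 ^ 2 + p.2 ^ 2) / 2) by simp only [hF]; ring,
        Real.exp_add, ← sub_mul, Real.norm_eq_abs, abs_mul, Real.abs_exp]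
      refine (hloc z hz p hp).trans ?_
      rw [add_assoc]
      refine le_add_of_le_of_nonneg ?_ (by positivity)
      rw [mul_assoc (C * _), show 3 * (2 * R) = 2 * (3 * R) by ring]
      gcongr
    · push Not at hp
      refine (norm_sub_le _ _).trans ?_
      -- Splitting `z g = g + (z - 1) g` and using `g ≤ c` only in the second summand keeps the
      -- integrable factor `exp g`.
      have e1 : ‖D.indicator (fun p => Real.exp (z * g p)) p‖ ≤
          D.indicator (fun p => Real.exp (1 * g p)) p * Real.exp ((z - 1) * c) := by
        by_cases hpD : p ∈ D
        · rw [Set.indicator_of_mem hpD, Set.indicator_of_mem hpD, Real.norm_eq_abs, Real.abs_exp,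
            ← Real.exp_add, Real.exp_le_exp]
          have := hgc p ⟨hpD, by rw [mem_closedBall_zero_iff]; exact not_le.2 hp⟩
          nlinarith
        · rw [Set.indicator_of_notMem hpD, Set.indicator_of_notMem hpD, norm_zero, zero_mul]
      have e2 : ‖perturbativeIntegrand P (2 * R) z p‖ ≤
          (2 * R : ℕ) * C' * z ^ (2 * R) * ((p.1 ^ (2 * L) + p.2 ^ (2 * L)) *
            Real.exp (-(z / 2 * (p.1 ^ 2 + p.2 ^ 2) / 2))) := by
        rw [perturbativeIntegrand, norm_mul, Real.norm_eq_abs (Real.exp _), Real.abs_exp,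
          ← mul_assoc]
        have e3 : ‖∑ k ∈ Finset.range (2 * R), z ^ k * (P p ^ k / (k.factorial : ℝ))‖ ≤
            (2 * R : ℕ) * C' * z ^ (2 * R) * (p.1 ^ (2 * L) + p.2 ^ (2 * L)) := by
          refine (norm_sum_le _ _).trans ?_
          refine (Finset.sum_le_card_nsmul _ _
            (z ^ (2 * R) * (C' * (p.1 ^ (2 * L) + p.2 ^ (2 * L)))) fun k hk => ?_).trans_eq ?_
          · have hk' := (Finset.mem_range.1 hk).le
            have hfac : (1 : ℝ) ≤ k.factorial := by exact_mod_cast Nat.factorial_pos k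
            rw [norm_mul, norm_div, norm_pow, norm_pow, Real.norm_of_nonneg hz0.le,
              Real.norm_natCast, Real.norm_eq_abs]
            have e4 : |P p| ^ k / (k.factorial : ℝ) ≤ C' * (p.1 ^ (2 * L) + p.2 ^ (2 * L)) :=
              (div_le_self (by positivity) hfac).trans ((hfar p hp.le k hk').trans (by gcongr))
            have e5 : z ^ k ≤ z ^ (2 * R) := pow_le_pow_right₀ hz hk'
            gcongr
          · rw [Finset.card_range, nsmul_eq_mul]
            ring
        have e6 : Real.exp (-(z * (p.1 ^ 2 + p.2 ^ 2) / 2)) ≤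
            Real.exp (-(z / 2 * (p.1 ^ 2 + p.2 ^ 2) / 2)) := by
          rw [Real.exp_le_exp, neg_le_neg_iff]
          have : 0 ≤ p.1 ^ 2 + p.2 ^ 2 := by positivity
          nlinarith
        gcongr
      have e7 : 0 ≤ C * z ^ (2 * R) * ((p.1 ^ (2 * (3 * R)) + p.2 ^ (2 * (3 * R))) *
        Real.exp (-(z / 2 * (p.1 ^ 2 + p.2 ^ 2) / 2))) := by positivity
      linarith
  have hind (z : ℝ) (hz : 0 < z) : Integrable (D.indicator fun p => Real.exp (z * g p)) :=
    (hint z hz).integrable_indicator₀ hD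
  have hbound : ∀ᶠ z : ℝ in atTop, ‖laplaceIntegral D g z - z / (2 * Real.pi) *
      (∫ p, perturbativeIntegrand P (2 * R) z p)‖ ≤
      ‖C * (4 * numPairings (2 * (3 * R)) * 2 ^ (3 * R)) * (z ^ (2 * R) * (z ^ (3 * R))⁻¹) +
      (2 * R : ℕ) * C' * (4 * numPairings (2 * L) * 2 ^ L) * (z ^ (2 * R) * (z ^ L)⁻¹) +
      z / (2 * Real.pi) * ((∫ p, D.indicator (fun p => Real.exp (1 * g p)) p) *
        Real.exp ((z - 1) * c))‖ := by
    filter_upwards [eventually_ge_atTop 1] with z hz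
    have hz0 : 0 < z := by linarith
    refine le_trans ?_ (le_abs_self _)
    rw [laplaceIntegral, ← mul_sub, ← integral_indicator₀ hD,
      ← integral_sub (hind z hz0) (integrable_perturbativeIntegrand ht3 hM hz0), norm_mul,
      Real.norm_of_nonneg (by positivity)]
    have i1 := (integrable_even_pow_mul_exp hz0 (3 * R)).const_mul (C * z ^ (2 * R))
    have i2 := (integrable_even_pow_mul_exp hz0 L).const_mul ((2 * R : ℕ) * C' * z ^ (2 * R))
    have i3 := (hind 1 one_pos).mul_const (Real.exp ((z - 1) * c))
    have hle := norm_integral_le_of_norm_le ((i1.add i2).add i3)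
      (Eventually.of_forall fun p => hpt z hz p)
    refine (mul_le_mul_of_nonneg_left hle (by positivity)).trans_eq ?_
    have hadd := (integral_add (i1.add i2) i3).trans
      (congrArg (· + _) (integral_add i1 i2))
    refine (congrArg (z / (2 * Real.pi) * ·) hadd).trans ?_
    rw [integral_const_mul, integral_const_mul, integral_mul_const]
    linear_combination (C * z ^ (2 * R)) * integral_even_pow_mul_exp hz0 (3 * R) +
      ((2 * R : ℕ) * C' * z ^ (2 * R)) * integral_even_pow_mul_exp hz0 L
  refine (IsBigO.of_bound' hbound).trans
    (((pow_mul_inv_pow_isBigO _ le_rfl).add (pow_mul_inv_pow_isBigO _ ?_)).add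
      (mul_exp_isBigO hc _ R))
  -- `L = 12 R²` is at least `3R`, so the tail is also `O(z^(-R))`.
  rw [hL]
  nlinarith [Nat.le_mul_self R]

end LaplaceMethod

/-! ### The main theorem -/

theorem mainTheorem3 (D : Set (ℝ × ℝ)) (g : ℝ × ℝ → ℝ) (Λ : ℕ → ℕ → ℝ)
    (hD : NullMeasurableSet D volume)
    (hint : ∀ z : ℝ, 0 < z → IntegrableOn (fun p => Real.exp (z * g p)) D volume)
    (hnhds : D ∈ 𝓝 (0 : ℝ × ℝ))
    (hsup : ∀ U ∈ 𝓝 (0 : ℝ × ℝ), ∃ c < g 0, ∀ p ∈ D \ U, g p ≤ c)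
    (hexp : ∀ᶠ p in 𝓝 (0 : ℝ × ℝ),
      HasSum
        (fun m : {m : ℕ × ℕ // 3 ≤ m.1 + m.2} =>
          Λ m.1.1 m.1.2 * (p.1 ^ m.1.1 * p.2 ^ m.1.2 /
            ((m.1.1.factorial : ℝ) * (m.1.2.factorial : ℝ))))
        (g p - (-(p.1 ^ 2 / 2) - p.2 ^ 2 / 2))) :
    (∀ n : ℕ, (BicoloredGraph.graphsStar n).Finite) ∧
      HasAsymptoticExpansion (laplaceIntegral D g) (BicoloredGraph.coeffA Λ) := by
  refine ⟨BicoloredGraph.graphsStar_finite, fun R => ?_⟩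
  -- Values of `Λ` in total degree below 3 occur neither in the series nor in the graphs. Setting
  -- them to 0 lets the series run over all of `ℕ × ℕ` and makes graphs with small vertices
  -- contribute nothing.
  set Λ' : ℕ → ℕ → ℝ := fun u w => if u + w < 3 then 0 else Λ u w with hΛ'
  have h3 : ∀ u w, u + w < 3 → Λ' u w = 0 := fun u w h => if_pos h
  have hA : BicoloredGraph.coeffA Λ = BicoloredGraph.coeffA Λ' := by
    funext n
    refine finsum_mem_congr rfl fun G hG => ?_
    rw [BicoloredGraph.weight, BicoloredGraph.weight]
    congr 1
    refine Finset.prod_congr rfl fun v hv => ?_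
    rw [hΛ']
    exact (if_neg (not_lt.2 (hG.1 v hv))).symm
  have hexp' : ∀ᶠ p in 𝓝 (0 : ℝ × ℝ), HasSum (fun m : ℕ × ℕ =>
      Λ' m.1 m.2 * (p.1 ^ m.1 * p.2 ^ m.2 / ((m.1.factorial : ℝ) * (m.2.factorial : ℝ))))
        (g p - (-(p.1 ^ 2 / 2) - p.2 ^ 2 / 2)) := by
    filter_upwards [hexp] with p hp
    have h := hasSum_subtype_iff_indicator (s := {m : ℕ × ℕ | 3 ≤ m.1 + m.2})
      (f := fun m : ℕ × ℕ => Λ m.1 m.2 * (p.1 ^ m.1 * p.2 ^ m.2 /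
        ((m.1.factorial : ℝ) * (m.2.factorial : ℝ)))) |>.1 hp
    refine h.congr_fun fun m => ?_
    simp only [hΛ', Set.indicator_apply, Set.mem_ofPred_eq]
    split_ifs <;> first | omega | simp
  -- At the origin every term of the series vanishes. This normalizes the supremum to 0, so that `c
  -- < g 0` means exponential decay.
  have h0 : g 0 = 0 := by
    have h := hexp'.self_of_nhds
    have hz : (fun m : ℕ × ℕ => Λ' m.1 m.2 * ((0 : ℝ × ℝ).1 ^ m.1 * (0 : ℝ × ℝ).2 ^ m.2 /
        ((m.1.factorial : ℝ) * (m.2.factorial : ℝ)))) = fun _ => 0 := by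
      funext m
      rcases Nat.eq_zero_or_pos m.1 with h1 | h1
      · rcases Nat.eq_zero_or_pos m.2 with h2 | h2
        · rw [h3 _ _ (by omega), zero_mul]
        · simp [h2.ne']
      · simp [h1.ne']
    rw [hz] at h
    simpa using h.unique hasSum_zero
  rw [hA]
  refine ((laplaceIntegral_sub_perturbative_isBigO hD hint hnhds h0 hsup h3 hexp' R).add
    (perturbative_sub_coeffA_isBigO h3 R)).congr_left fun z => ?_
  ring
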